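/- There is a universal constant $C>0$ such that the following holds for all integers $N\ge 1$, $m\ge 0$, $T\ge 2$ and every real $L$; put $\hat m=m+1$. **Problem.** For customers $i\in[N]$ and events $t\in[T]$ let features $x_{i,t}\in\mathbb R^m$, loads $d_{i,t}\in\mathbb R$, payments $r_{i,t}\in\mathbb R$ and budgets $b_t\in\mathbb R$ be given (known and deterministic), with context vectors $\hat x_{i,t}=(1,x_{i,t})\in\mathbb R^{\hat m}$ normalized so that $\|\hat x_{i,t}\|_\infty\le 1$, and let $$\bar d=\sup_{i,t}d_{i,t},\qquad \underline d=\inf_{i,t}d_{i,t}>0,\qquad \bar D=\sup_{t\in[T]}\sum_{i\in[N]}d_{i,t}.$$ Let $\phi(u)=1/(1+e^{-u})$. The unknown parameter $\Theta=(\theta_i)_{i\in[N]}$, $\theta_i\in\mathbb R^{\hat m}$, has a prior distribution $\mathcal P$ (any Borel probability measure on $\mathbb R^{N\hat m}$) with $\|\Theta\|_\infty\le L$ almost surely. At each event $t$ a set $S_t\in\mathcal A_t=\{S\subseteq[N]:\sum_{i\in S}r_{i,t}\le b_t\}$ is selected (all $\mathcal A_t$ are assumed non-empty), the outcomes $z_{i,t}\in\{0,1\}$,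 $i\in S_t$, are observed, and $\sum_{i\in S_t}d_{i,t}z_{i,t}$ is received. Given $\Theta$, the $z_{i,t}$ are independent over $i$ and $t$, independent of the selections up to time $t$, and Bernoulli with mean $\phi(\hat x_{i,t}^\top\theta_i)$. Let $f_t^\Theta(S)=\sum_{i\in S}d_{i,t}\,\phi(\hat x_{i,t}^\top\theta_i)$ be the mean reward. **Algorithm (online learning and selection by Thompson sampling, with exact Bayesian inference).** At each event $t$, sample $\hat\Theta_t=(\hat\theta_{i,t})_i$ from the exact posterior distribution of $\Theta$ given the selections and the observed outcomes of the events before $t$ (obtained from $\mathcal P$ by Bayes' rule with the likelihood $\prod_{i\in S}\phi((2z_i-1)\hat x_{i,t}^\top\theta_i)$ of one round), put $p_{i,t}=\phi(\hat x_{i,t}^\top\hat\theta_{i,t})$, and select $S_t=\mathcal O_t(p_t)$, where the offline oracle $\mathcal O_t$ is any measurable map that sends each $p\in[0,1]^N$ to a maximizer of $\sum_{i\in S}d_{i,t}p_i$ over $S\in\mathcal A_t$. **Claim.** With $S_t^*\in\arg\max_{S\in\mathcal A_t}f_t^\Theta(S)$ and $$\mathrm{Regret}(T,\Theta)=\sum_{t=1}^T\mathbb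 E\big[f_t^\Theta(S_t^*)-f_t^\Theta(S_t)\,\big|\,\Theta\big],\qquad \mathrm{BayRegret}(T)=\mathbb E_{\Theta\sim\mathcal P}\big[\mathrm{Regret}(T,\Theta)\big],$$ the regret $\mathrm{Regret}(T,\Theta)$ is $\mathcal P$-integrable and $$\mathrm{BayRegret}(T)\le C\,\bar D\,\hat m\,N^{3/2}\,e^{\hat mL}\,\frac{\bar d}{\underline d}\,\sqrt T\,\log T .$$ -/

import Mathlib

open MeasureTheory

/-- The known data of a customer-selection problem with `N` customers and `m` environmental factors:
feature vectors `x t i`, reducible loads `d t i`, payments `r t i` and budgets `b t`. The DR events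
are numbered `t = 0, 1, 2, …`; a problem with horizon `T` only uses `t < T`. -/
structure DRInstance (N m : ℕ) where
  x : ℕ → Fin N → Fin m → ℝ
  d : ℕ → Fin N → ℝ
  r : ℕ → Fin N → ℝ
  b : ℕ → ℝ

/-- The parameters `Θ = (θ_i)_i` with `θ_i = (α_i, β_i) ∈ ℝ^(m+1)`. The norm of this type is
the sup norm over all `N (m+1)` coordinates. -/
abbrev DRParam (N m : ℕ) := Fin N → Fin (m + 1) → ℝ

/-- What happens in one event: the set of selected customers, and the stay-in (`true`) or opt-out
(`false`) variables of the customers. Only the outcomes of selected customers are observed, see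
`DRInstance.likelihood`. -/
abbrev DRRound (N : ℕ) := Finset (Fin N) × (Fin N → Bool)

/-- The rounds before event `t`. -/
abbrev DRHistory (N t : ℕ) := Fin t → DRRound N

namespace DRInstance

variable {N m : ℕ}

/-- The context vector `(1, x_{i,t})`. -/
def context (D : DRInstance N m) (t : ℕ) (i : Fin N) : Fin (m + 1) → ℝ :=
  Fin.cons 1 (D.x t i)

/-- The linear predictor, the inner product of the context vector and `θ_i`. -/
def score (D : DRInstance N m) (θ : DRParam N m) (t : ℕ) (i : Fin N) : ℝ :=
  ∑ j, D.context t i j * θ i j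

/-- The probability that customer `i` stays in, if selected at event `t`. -/
noncomputable def stayProb (D : DRInstance N m) (θ : DRParam N m) (t : ℕ) (i : Fin N) : ℝ :=
  Real.sigmoid (D.score θ t i)

/-- The objective of the selection problem at event `t` for the probability profile `p`. -/
def objective (D : DRInstance N m) (t : ℕ) (p : Fin N → ℝ) (S : Finset (Fin N)) : ℝ :=
  ∑ i ∈ S, D.d t i * p i

/-- The budget constraint. -/
def Feasible (D : DRInstance N m) (t : ℕ) (S : Finset (Fin N)) : Prop :=
  ∑ i ∈ S, D.r t i ≤ D.b t

/-- `S` is an optimal selection at event `t` for the probability profile `p`. -/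
def IsOptimal (D : DRInstance N m) (t : ℕ) (p : Fin N → ℝ) (S : Finset (Fin N)) : Prop :=
  D.Feasible t S ∧ ∀ S', D.Feasible t S' → D.objective t p S' ≤ D.objective t p S

/-- The expected reward `f_t^Θ(S)`. -/
noncomputable def meanReward (D : DRInstance N m) (t : ℕ) (θ : DRParam N m)
    (S : Finset (Fin N)) : ℝ :=
  D.objective t (D.stayProb θ t) S

/-- The likelihood of the outcomes that are observed in one round at event `t`: the product, over
the selected customers, of `φ((2z - 1) s)` with `φ` the logistic function and `s` the score. -/
noncomputable def likelihood (D : DRInstance N m) (t : ℕ) (ρ : DRRound N) (θ : DRParam N m) : ℝ :=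
  ∏ i ∈ ρ.1, Real.sigmoid ((if ρ.2 i then 1 else -1) * D.score θ t i)

/-- Bayes' rule for one round at event `t`, applied to the belief `P`. -/
noncomputable def bayesUpdate (D : DRInstance N m) (t : ℕ) (P : Measure (DRParam N m))
    (ρ : DRRound N) : Measure (DRParam N m) :=
  (∫⁻ θ, ENNReal.ofReal (D.likelihood t ρ θ) ∂P)⁻¹ •
    P.withDensity (fun θ => ENNReal.ofReal (D.likelihood t ρ θ))

/-- The exact posterior distribution of the parameters after a history. -/
noncomputable def posterior (D : DRInstance N m) (prior : Measure (DRParam N m)) :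
    (t : ℕ) → DRHistory N t → Measure (DRParam N m)
  | 0, _ => prior
  | t + 1, h => D.bayesUpdate t (D.posterior prior t (Fin.init h)) (h (Fin.last t))

/-- The distribution of the selection that the online learning and selection algorithm makes at
event `t` after the history `h`: sample parameters from the posterior, compute the probability
profile, and call the offline oracle. -/
noncomputable def selectionLaw (D : DRInstance N m) (prior : Measure (DRParam N m))
    (oracle : ℕ → (Fin N → ℝ) → Finset (Fin N)) (t : ℕ) (h : DRHistory N t) :
    Measure (Finset (Fin N)) :=
  (D.posterior prior t h).map (fun θ' => oracle t (D.stayProb θ' t))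

/-- The distribution of the outcomes at event `t` under the true parameters `θ`: independent
Bernoulli variables, `true` with probability `stayProb`. -/
noncomputable def outcomeLaw (D : DRInstance N m) (θ : DRParam N m) (t : ℕ) :
    Measure (Fin N → Bool) :=
  Measure.pi fun i =>
    ProbabilityTheory.bernoulliMeasure true false (unitInterval.sigmoid (D.score θ t i))

/-- The distribution of the first `t` rounds of the algorithm under the true parameters `θ`. -/
noncomputable def historyLaw (D : DRInstance N m) (prior : Measure (DRParam N m))
    (oracle : ℕ → (Fin N → ℝ) → Finset (Fin N)) (θ : DRParam N m) :
    (t : ℕ) → Measure (DRHistory N t)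
  | 0 => Measure.dirac Fin.elim0
  | t + 1 => (D.historyLaw prior oracle θ t).bind fun h =>
      ((D.selectionLaw prior oracle t h).prod (D.outcomeLaw θ t)).map fun ρ =>
        (Fin.snoc h ρ : DRHistory N (t + 1))

/-- The `T`-period regret under the true parameters `θ`, where `Sstar t θ` is the optimal selection
at event `t` for known `θ`. -/
noncomputable def regret (D : DRInstance N m) (prior : Measure (DRParam N m))
    (oracle : ℕ → (Fin N → ℝ) → Finset (Fin N)) (Sstar : ℕ → DRParam N m → Finset (Fin N))
    (T : ℕ) (θ : DRParam N m) : ℝ :=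
  ∑ t : Fin T, ∫ h : DRHistory N T,
    (D.meanReward t θ (Sstar t θ) - D.meanReward t θ (h t).1) ∂(D.historyLaw prior oracle θ T)

/-- The `T`-period Bayesian regret. -/
noncomputable def bayesRegret (D : DRInstance N m) (prior : Measure (DRParam N m))
    (oracle : ℕ → (Fin N → ℝ) → Finset (Fin N)) (Sstar : ℕ → DRParam N m → Finset (Fin N))
    (T : ℕ) : ℝ :=
  ∫ θ, D.regret prior oracle Sstar T θ ∂prior

/-- The largest load of a customer over the horizon. -/
noncomputable def dSup (D : DRInstance N m) (T : ℕ) : ℝ :=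
  ⨆ q : Fin T × Fin N, D.d q.1 q.2

/-- The smallest load of a customer over the horizon. -/
noncomputable def dInf (D : DRInstance N m) (T : ℕ) : ℝ :=
  ⨅ q : Fin T × Fin N, D.d q.1 q.2

/-- The largest total load over the horizon. -/
noncomputable def totalSup (D : DRInstance N m) (T : ℕ) : ℝ :=
  ⨆ t : Fin T, ∑ i, D.d t i

end DRInstance

/-! The proof is an information-theoretic analysis of Thompson sampling. Given the history, the
selection `S_t` is drawn independently of `Θ`, but with the same law as the oracle's choice for the
true `Θ`. So the conditional regret of one round is the posterior mean of `∑ d_i (p_i(Θ) - p̄_i)`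
over the customers `i` in the oracle's choice for `Θ`, where `p̄_i` is the posterior mean of
`p_i(Θ)`. Membership of `i` in that choice is correlated with `p_i(Θ)`; `mul_setIntegral_le`
decouples the two by AM-GM, and each term is at most `d_i² / (4λ) + λ P(i ∈ S_t) Var(p_i)`
(`integral_stepRegret_le`).

The products `P(i ∈ S_t) Var(p_i)` are paid for by information. If `i` is selected, its outcome is
observed, and by a Pinsker-type inequality `(p_i(Θ) - p̄_i)²` is at most the relative entropy
between the true and the predictive law of the round. Summing over the selected customers costs a
factor `N`. By the chain rule the relative entropies add up over the rounds to the mutual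
information of `Θ` and the observed history (`sum_gain_le_information`).

That information is at most one plus the logarithm of a covering number (`information_le`): the
log-likelihood is Lipschitz in the parameters, so a grid on the cube `[-L, L]^(N(m+1))` with about
`m̂ L N T` points per axis dominates the likelihood up to a factor `e`. The logarithm is absorbed
into `e^(m̂L)` and `log T`, and a suitable `λ` finishes the proof.

The histories in the model also carry outcomes of unselected customers. As nothing depends on these,
they can be given uniform weights, and then the weight of a history is its likelihood times a factor
free of `Θ` (`integral_historyLaw`). All averages over histories thereby become finite sums. -/

/-! ### Finite sums against product weights -/

/-- Under a product of weights with unit sums, a function of one coordinate is averaged with the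
weights of that coordinate. -/
theorem sum_prod_mul_apply {ι κ : Type*} [Fintype ι] [DecidableEq ι] [Fintype κ]
    (b : ι → κ → ℝ) (hb : ∀ i, ∑ c, b i c = 1) (i : ι) (g : κ → ℝ) :
    ∑ z : ι → κ, (∏ j, b j (z j)) * g (z i) = ∑ c, b i c * g c := by
  have h : ∀ z : ι → κ, (∏ j, b j (z j)) * g (z i)
      = ∏ j, (b j (z j) * if j = i then g (z j) else 1) := by
    intro z
    rw [Finset.prod_mul_distrib, Finset.prod_ite_eq' Finset.univ i]
    simp
  simp_rw [h]
  rw [← Fintype.prod_sum (fun j c => b j c * if j = i then g c else 1),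
    ← Finset.mul_prod_erase Finset.univ _ (Finset.mem_univ i)]
  have h2 : ∏ j ∈ Finset.univ.erase i, ∑ c, (b j c * if j = i then g c else 1) = 1 := by
    refine Finset.prod_eq_one fun j hj => ?_
    simp [Finset.ne_of_mem_erase hj, hb]
  rw [h2]
  simp

/-- A function that looks at the coordinates through the maps `f i` is averaged in the same way by
any two products of weights with the same pushforwards. -/
theorem sum_prod_mul_comp_congr {ι κ κ' : Type*} [Fintype ι] [DecidableEq ι] [Fintype κ]
    [Fintype κ'] [DecidableEq κ'] (b b' : ι → κ → ℝ) (f : ι → κ → κ')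
    (hb : ∀ i w, ∑ c with f i c = w, b i c = ∑ c with f i c = w, b' i c)
    (g : (ι → κ') → ℝ) :
    ∑ z : ι → κ, (∏ j, b j (z j)) * g (fun j => f j (z j))
      = ∑ z : ι → κ, (∏ j, b' j (z j)) * g (fun j => f j (z j)) := by
  -- Grouping the sum by the fibres of the coordinate maps leaves only the pushforward weights.
  have key : ∀ b : ι → κ → ℝ, ∑ z : ι → κ, (∏ j, b j (z j)) * g (fun j => f j (z j))
      = ∑ w : ι → κ', (∏ j, ∑ c with f j c = w j, b j c) * g w := by
    intro b
    rw [← Finset.sum_fiberwise Finset.univ (fun z : ι → κ => fun j => f j (z j))]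
    refine Finset.sum_congr rfl fun w _ => ?_
    rw [Finset.prod_univ_sum, Finset.sum_mul]
    refine Finset.sum_congr ?_ fun z hz => ?_
    · ext z
      simp [funext_iff]
    · rw [Fintype.mem_piFinset] at hz
      congr 2
      funext j
      simpa using hz j
  simp_rw [key, hb]

/-! ### Analytic inequalities: relative entropy, decoupling, the logistic function, grids -/

/-- Apply `log u ≤ u - 1` to `u = √y / √x`. Summed over two probability vectors, the term `x - y`
vanishes, and what remains bounds the squared Hellinger distance by the relative entropy. -/
theorem sub_add_sq_sqrt_sub_le_mul_log {x y : ℝ} (hx : 0 < x) (hy : 0 < y) :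
    x - y + (√x - √y) ^ 2 ≤ x * Real.log (x / y) := by
  have h1 : Real.log (x / y) = -2 * Real.log (√y / √x) := by
    rw [Real.log_div (by positivity) (by positivity), Real.log_div (by positivity) (by positivity),
      Real.log_sqrt hx.le, Real.log_sqrt hy.le]
    ring
  have h2 : Real.log (√y / √x) ≤ √y / √x - 1 := Real.log_le_sub_one_of_pos (by positivity)
  have hxx : √x * √x = x := Real.mul_self_sqrt hx.le
  have hyy : √y * √y = y := Real.mul_self_sqrt hy.le
  have h3 : x * (√y / √x) = √x * √y := by
    have : √x ≠ 0 := by positivity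
    field_simp
    nlinarith
  rw [h1]
  nlinarith [mul_le_mul_of_nonneg_left h2 hx.le]

/-- The squared difference of the means of a function with values in `[0, 1]` is at most the
relative entropy. -/
theorem sq_sum_sub_sum_le_sum_mul_log {α : Type*} [Fintype α] (p q g : α → ℝ)
    (hp : ∀ a, 0 < p a) (hq : ∀ a, 0 < q a) (hp1 : ∑ a, p a = 1) (hq1 : ∑ a, q a = 1)
    (hg : ∀ a, g a ∈ Set.Icc (0 : ℝ) 1) :
    (∑ a, p a * g a - ∑ a, q a * g a) ^ 2 ≤ ∑ a, p a * Real.log (p a / q a) := by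
  have h1 : ∑ a, (√(p a) - √(q a)) ^ 2 ≤ ∑ a, p a * Real.log (p a / q a) := by
    have := Finset.sum_le_sum fun a (_ : a ∈ Finset.univ) =>
      sub_add_sq_sqrt_sub_le_mul_log (hp a) (hq a)
    simpa [Finset.sum_add_distrib, Finset.sum_sub_distrib, hp1, hq1] using this
  -- Both vectors have sum one, so `g` may be centred at `1 / 2`. The centring makes the second
  -- Cauchy–Schwarz factor at most one.
  have h2 : ∑ a, p a * g a - ∑ a, q a * g a
      = ∑ a, (√(p a) - √(q a)) * ((√(p a) + √(q a)) * (g a - 1 / 2)) := by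
    have : ∀ a, (√(p a) - √(q a)) * ((√(p a) + √(q a)) * (g a - 1 / 2))
        = (p a * g a - q a * g a) - (p a - q a) * (1 / 2) := by
      intro a
      have e1 : √(p a) * √(p a) = p a := Real.mul_self_sqrt (hp a).le
      have e2 : √(q a) * √(q a) = q a := Real.mul_self_sqrt (hq a).le
      linear_combination (g a - 1 / 2) * e1 - (g a - 1 / 2) * e2
    simp_rw [this, Finset.sum_sub_distrib, ← Finset.sum_mul, Finset.sum_sub_distrib, hp1, hq1]
    ring
  have h3 : ∑ a, ((√(p a) + √(q a)) * (g a - 1 / 2)) ^ 2 ≤ 1 := by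
    have : ∀ a, ((√(p a) + √(q a)) * (g a - 1 / 2)) ^ 2 ≤ (p a + q a) * (1 / 2) := by
      intro a
      have e1 : √(p a) * √(p a) = p a := Real.mul_self_sqrt (hp a).le
      have e2 : √(q a) * √(q a) = q a := Real.mul_self_sqrt (hq a).le
      have e3 : (√(p a) + √(q a)) ^ 2 ≤ 2 * (p a + q a) := by
        nlinarith [sq_nonneg (√(p a) - √(q a))]
      have e4 : (g a - 1 / 2) ^ 2 ≤ 1 / 4 := by nlinarith [(hg a).1, (hg a).2]
      rw [mul_pow]
      nlinarith [sq_nonneg (√(p a) + √(q a)), sq_nonneg (g a - 1 / 2), hp a, hq a]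
    refine (Finset.sum_le_sum fun a _ => this a).trans ?_
    rw [← Finset.sum_mul, Finset.sum_add_distrib, hp1, hq1]
    norm_num
  rw [h2]
  refine (Finset.sum_mul_sq_le_sq_mul_sq _ _ _).trans (le_trans ?_ h1)
  exact mul_le_of_le_one_right (Finset.sum_nonneg fun a _ => sq_nonneg _) h3

/-- Decoupling of an event from a random variable. -/
theorem mul_setIntegral_le {Ω : Type*} [MeasurableSpace Ω] (ν : Measure Ω) [IsProbabilityMeasure ν]
    (A : Set Ω) {f : Ω → ℝ} (hf : Integrable f ν)
    (hf2 : Integrable (fun ω => f ω ^ 2) ν) (d : ℝ) {lam : ℝ} (hlam : 0 < lam) :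
    d * ∫ ω in A, f ω ∂ν ≤ d ^ 2 / (4 * lam) + lam * (ν.real A * ∫ ω, f ω ^ 2 ∂ν) := by
  have hI : 0 ≤ ∫ ω, f ω ^ 2 ∂ν := integral_nonneg fun ω => sq_nonneg _
  rcases (measureReal_nonneg (μ := ν) (s := A)).eq_or_lt with hq | hq
  · have : ν A = 0 := by simpa [measureReal_def, ENNReal.toReal_eq_zero_iff] using hq.symm
    rw [Measure.restrict_eq_zero.mpr this]
    simp only [integral_zero_measure, mul_zero]
    positivity
  · set q := ν.real A
    -- AM-GM with a weight proportional to `q`, the mass of `A`: integrated over `A`, the constant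
    -- term loses its `1 / q`, while the quadratic term keeps the factor `q`.
    have hpt : ∀ ω, d * f ω ≤ d ^ 2 / (4 * lam * q) + lam * q * f ω ^ 2 := by
      intro ω
      have : 0 ≤ (d / (2 * (lam * q)) - f ω) ^ 2 * (lam * q) := by positivity
      have e : (d / (2 * (lam * q)) - f ω) ^ 2 * (lam * q)
          = d ^ 2 / (4 * lam * q) + lam * q * f ω ^ 2 - d * f ω := by
        field_simp
        ring
      linarith
    have hmono : ∫ ω in A, d * f ω ∂ν
        ≤ ∫ ω in A, (d ^ 2 / (4 * lam * q) + lam * q * f ω ^ 2) ∂ν :=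
      integral_mono (hf.const_mul d).integrableOn
        (((integrable_const _).add (hf2.const_mul _)).integrableOn) hpt
    rw [integral_const_mul, integral_add (integrable_const _).integrableOn
      (hf2.const_mul _).integrableOn, integral_const_mul] at hmono
    simp only [integral_const, measureReal_restrict_apply_univ, smul_eq_mul] at hmono
    have h1 : ∫ ω in A, f ω ^ 2 ∂ν ≤ ∫ ω, f ω ^ 2 ∂ν :=
      setIntegral_le_integral hf2 (Filter.Eventually.of_forall fun ω => sq_nonneg _)
    have h2 : ν.real A * (d ^ 2 / (4 * lam * q)) = d ^ 2 / (4 * lam) := by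
      change q * _ = _
      field_simp
    rw [h2] at hmono
    have h3 := mul_le_mul_of_nonneg_left h1 (mul_pos hlam hq).le
    linarith

/-- The logarithm of the logistic function is 1-Lipschitz. This gives a Lipschitz bound on the
log-likelihood that does not depend on the outcomes. -/
theorem Real.sigmoid_le_exp_abs_sub_mul (x y : ℝ) :
    Real.sigmoid x ≤ Real.exp |x - y| * Real.sigmoid y := by
  rw [Real.sigmoid_def, Real.sigmoid_def, ← div_eq_mul_inv, inv_eq_one_div,
    div_le_div_iff₀ (by positivity) (by positivity), one_mul, mul_add, mul_one, ← Real.exp_add]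
  refine add_le_add (Real.one_le_exp (abs_nonneg _)) (Real.exp_le_exp.mpr ?_)
  linarith [le_abs_self (x - y)]

/-- The points `-L + 2 L j / k` with `j ≤ k` are `2 L / k`-dense in `[-L, L]`. -/
theorem exists_grid_point_near {L : ℝ} {k : ℕ} (hk : 0 < k) {x : ℝ} (hx : |x| ≤ L) :
    ∃ j : Fin (k + 1), |x - (-L + 2 * L / k * (j : ℕ))| ≤ 2 * L / k := by
  have hk' : (0 : ℝ) < k := by exact_mod_cast hk
  obtain ⟨h1, h2⟩ := abs_le.mp hx
  rcases (show 0 ≤ L by linarith).eq_or_lt with hL | hL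
  · subst hL
    refine ⟨0, ?_⟩
    have : x = 0 := by linarith
    simp [this]
  set u := (x + L) * k / (2 * L) with hu
  have hu0 : 0 ≤ u := by
    have : 0 ≤ x + L := by linarith
    positivity
  have huk : u ≤ k := by
    rw [hu, div_le_iff₀ (by positivity)]
    nlinarith
  have hux : x = -L + 2 * L / k * u := by
    rw [hu]
    field_simp
    ring
  have hfl : ⌊u⌋₊ < k + 1 := Nat.lt_succ_of_le (by exact_mod_cast (Nat.floor_le hu0).trans huk)
  refine ⟨⟨⌊u⌋₊, hfl⟩, ?_⟩
  have e : x - (-L + 2 * L / k * (⌊u⌋₊ : ℝ)) = 2 * L / k * (u - ⌊u⌋₊) := by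
    rw [hux]
    ring_nf
  simp only
  rw [e, abs_of_nonneg (mul_nonneg (by positivity) (by linarith [Nat.floor_le hu0]))]
  exact mul_le_of_le_one_right (by positivity) (by linarith [Nat.lt_floor_add_one u])

namespace DRInstance

variable {N m : ℕ}

/-! ### Likelihood of a history -/

section Likelihood

variable (D : DRInstance N m)

theorem measurable_score (t : ℕ) (i : Fin N) : Measurable fun θ => D.score θ t i := by
  unfold score
  fun_prop

theorem measurable_sigmoid_mul_score (t : ℕ) (i : Fin N) (c : ℝ) :
    Measurable fun θ => Real.sigmoid (c * D.score θ t i) :=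
  continuous_sigmoid.measurable.comp ((D.measurable_score t i).const_mul c)

theorem measurable_stayProb (t : ℕ) (i : Fin N) : Measurable fun θ => D.stayProb θ t i :=
  continuous_sigmoid.measurable.comp (D.measurable_score t i)

theorem stayProb_mem_Icc (θ : DRParam N m) (t : ℕ) (i : Fin N) :
    D.stayProb θ t i ∈ Set.Icc (0 : ℝ) 1 :=
  ⟨Real.sigmoid_nonneg _, Real.sigmoid_le_one _⟩

theorem measurable_likelihood (t : ℕ) (ρ : DRRound N) : Measurable fun θ => D.likelihood t ρ θ := by
  unfold likelihood
  exact Finset.measurable_prod _ fun i _ => D.measurable_sigmoid_mul_score t i _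

theorem likelihood_pos (t : ℕ) (ρ : DRRound N) (θ : DRParam N m) : 0 < D.likelihood t ρ θ :=
  Finset.prod_pos fun _ _ => Real.sigmoid_pos _

theorem likelihood_le_one (t : ℕ) (ρ : DRRound N) (θ : DRParam N m) : D.likelihood t ρ θ ≤ 1 :=
  Finset.prod_le_one (fun _ _ => Real.sigmoid_nonneg _) fun _ _ => Real.sigmoid_le_one _

/-- The likelihood of the outcomes that are observed in a history. -/
noncomputable def histLik (D : DRInstance N m) : (t : ℕ) → DRHistory N t → DRParam N m → ℝ
  | 0, _, _ => 1
  | t + 1, h, θ => D.histLik t (Fin.init h) θ * D.likelihood t (h (Fin.last t)) θ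

theorem measurable_histLik : ∀ (t : ℕ) (h : DRHistory N t), Measurable fun θ => D.histLik t h θ
  | 0, _ => measurable_const
  | t + 1, h => (measurable_histLik t (Fin.init h)).mul (D.measurable_likelihood t _)

theorem histLik_pos : ∀ (t : ℕ) (h : DRHistory N t) (θ : DRParam N m), 0 < D.histLik t h θ
  | 0, _, _ => one_pos
  | t + 1, h, θ => mul_pos (histLik_pos t (Fin.init h) θ) (D.likelihood_pos t _ θ)

theorem histLik_le_one : ∀ (t : ℕ) (h : DRHistory N t) (θ : DRParam N m), D.histLik t h θ ≤ 1
  | 0, _, _ => le_rfl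
  | t + 1, h, θ =>
    mul_le_one₀ (histLik_le_one t (Fin.init h) θ) (D.likelihood_pos t _ θ).le
      (D.likelihood_le_one t _ θ)

@[simp]
theorem histLik_snoc (t : ℕ) (h : DRHistory N t) (ρ : DRRound N) (θ : DRParam N m) :
    D.histLik (t + 1) (Fin.snoc h ρ : DRHistory N (t + 1)) θ
      = D.histLik t h θ * D.likelihood t ρ θ := by
  simp [histLik]

theorem integrable_histLik (P : Measure (DRParam N m)) [IsFiniteMeasure P] (t : ℕ)
    (h : DRHistory N t) : Integrable (D.histLik t h) P :=
  Integrable.of_bound (D.measurable_histLik t h).aestronglyMeasurable 1 <| ae_of_all _ fun θ => by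
    rw [Real.norm_of_nonneg (D.histLik_pos t h θ).le]
    exact D.histLik_le_one t h θ

end Likelihood

/-! ### Closed form of the posterior -/

section Posterior

variable (D : DRInstance N m) (prior : Measure (DRParam N m))

/-- The normalizing constant of the posterior distribution. -/
noncomputable def evidence (t : ℕ) (h : DRHistory N t) : ℝ :=
  ∫ θ, D.histLik t h θ ∂prior

theorem evidence_pos [IsProbabilityMeasure prior] (t : ℕ) (h : DRHistory N t) :
    0 < D.evidence prior t h := by
  unfold evidence
  rw [integral_pos_iff_support_of_nonneg (fun θ => (D.histLik_pos t h θ).le)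
    (D.integrable_histLik prior t h)]
  have : Function.support (D.histLik t h) = Set.univ := by
    ext θ
    simp [(D.histLik_pos t h θ).ne']
  simp [this]

theorem lintegral_histLik [IsProbabilityMeasure prior] (t : ℕ) (h : DRHistory N t) :
    ∫⁻ θ, ENNReal.ofReal (D.histLik t h θ) ∂prior = ENNReal.ofReal (D.evidence prior t h) :=
  (ofReal_integral_eq_lintegral_ofReal (D.integrable_histLik prior t h)
    (ae_of_all _ fun θ => (D.histLik_pos t h θ).le)).symm

/-- The normalizing constants of the successive Bayes updates telescope, and the likelihoods
multiply. -/
theorem posterior_eq [IsProbabilityMeasure prior] : ∀ (t : ℕ) (h : DRHistory N t),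
    D.posterior prior t h = (ENNReal.ofReal (D.evidence prior t h))⁻¹ •
      prior.withDensity (fun θ => ENNReal.ofReal (D.histLik t h θ))
  | 0, h => by simp [posterior, evidence, histLik]
  | t + 1, h => by
    have hZ := D.evidence_pos prior t (Fin.init h)
    have hm : Measurable fun θ => ENNReal.ofReal (D.histLik t (Fin.init h) θ) :=
      (D.measurable_histLik t _).ennreal_ofReal
    have hm' : Measurable fun θ => ENNReal.ofReal (D.likelihood t (h (Fin.last t)) θ) :=
      (D.measurable_likelihood t _).ennreal_ofReal
    have hmul : ((fun θ => ENNReal.ofReal (D.histLik t (Fin.init h) θ)) *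
        fun θ => ENNReal.ofReal (D.likelihood t (h (Fin.last t)) θ))
        = fun θ => ENNReal.ofReal (D.histLik (t + 1) h θ) := by
      funext θ
      simp [histLik, ENNReal.ofReal_mul (D.histLik_pos t _ θ).le]
    simp only [posterior, bayesUpdate, posterior_eq t (Fin.init h)]
    rw [lintegral_smul_measure, lintegral_withDensity_eq_lintegral_mul _ hm hm', hmul,
      lintegral_histLik, withDensity_smul_measure, ← withDensity_mul _ hm hm', hmul, smul_smul,
      smul_eq_mul, ENNReal.mul_inv (.inr (by simp)) (.inl (by simp; exact hZ)), inv_inv,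
      mul_right_comm, ENNReal.mul_inv_cancel (ENNReal.ofReal_pos.mpr hZ).ne' (by simp), one_mul]

theorem integral_posterior [IsProbabilityMeasure prior] (t : ℕ) (h : DRHistory N t)
    (g : DRParam N m → ℝ) :
    ∫ θ, g θ ∂D.posterior prior t h
      = (D.evidence prior t h)⁻¹ * ∫ θ, D.histLik t h θ * g θ ∂prior := by
  have hZ := D.evidence_pos prior t h
  rw [posterior_eq, integral_smul_measure, integral_withDensity_eq_integral_toReal_smul
    (D.measurable_histLik t h).ennreal_ofReal (by simp)]
  simp only [smul_eq_mul, ENNReal.toReal_inv, ENNReal.toReal_ofReal hZ.le,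
    ENNReal.toReal_ofReal (D.histLik_pos t h _).le]

theorem evidence_mul_integral_posterior [IsProbabilityMeasure prior] (t : ℕ) (h : DRHistory N t)
    (g : DRParam N m → ℝ) :
    D.evidence prior t h * ∫ θ, g θ ∂D.posterior prior t h
      = ∫ θ, D.histLik t h θ * g θ ∂prior := by
  rw [integral_posterior, mul_inv_cancel_left₀ (D.evidence_pos prior t h).ne']

instance isProbabilityMeasure_posterior [IsProbabilityMeasure prior] (t : ℕ) (h : DRHistory N t) :
    IsProbabilityMeasure (D.posterior prior t h) := by
  constructor
  rw [posterior_eq, Measure.smul_apply, withDensity_apply _ MeasurableSet.univ,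
    Measure.restrict_univ, lintegral_histLik, smul_eq_mul]
  exact ENNReal.inv_mul_cancel (by simpa using D.evidence_pos prior t h) (by simp)

end Posterior

/-! ### Selection probabilities -/

section Selection

variable (D : DRInstance N m) (prior : Measure (DRParam N m))
  (oracle : ℕ → (Fin N → ℝ) → Finset (Fin N))

theorem measurable_oracle_stayProb {t : ℕ} (hO : Measurable (oracle t)) :
    Measurable fun θ => oracle t (D.stayProb θ t) :=
  hO.comp (measurable_pi_lambda _ fun i => D.measurable_stayProb t i)

theorem isProbabilityMeasure_selectionLaw [IsProbabilityMeasure prior] {t : ℕ}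
    (hO : Measurable (oracle t)) (h : DRHistory N t) :
    IsProbabilityMeasure (D.selectionLaw prior oracle t h) :=
  Measure.isProbabilityMeasure_map (D.measurable_oracle_stayProb oracle hO).aemeasurable

/-- The probability of a selection after a history. -/
noncomputable def selProb (t : ℕ) (h : DRHistory N t) (S : Finset (Fin N)) : ℝ :=
  (D.selectionLaw prior oracle t h).real {S}

theorem selProb_nonneg (t : ℕ) (h : DRHistory N t) (S : Finset (Fin N)) :
    0 ≤ D.selProb prior oracle t h S :=
  measureReal_nonneg

theorem sum_selProb_mul [IsProbabilityMeasure prior] {t : ℕ} (hO : Measurable (oracle t))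
    (h : DRHistory N t) (F : Finset (Fin N) → ℝ) :
    ∑ S, D.selProb prior oracle t h S * F S
      = ∫ θ, F (oracle t (D.stayProb θ t)) ∂D.posterior prior t h := by
  have := D.isProbabilityMeasure_selectionLaw prior oracle hO h
  rw [← integral_map (D.measurable_oracle_stayProb oracle hO).aemeasurable
    (measurable_of_countable F).aestronglyMeasurable, integral_fintype .of_finite]
  rfl

theorem sum_selProb [IsProbabilityMeasure prior] {t : ℕ} (hO : Measurable (oracle t))
    (h : DRHistory N t) : ∑ S, D.selProb prior oracle t h S = 1 := by
  simpa using D.sum_selProb_mul prior oracle hO h fun _ => 1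

end Selection

variable (D : DRInstance N m) (prior : Measure (DRParam N m))
  (oracle : ℕ → (Fin N → ℝ) → Finset (Fin N))

/-! ### One-step recursion for the history law -/

theorem outcomeLaw_real_singleton (θ : DRParam N m) (t : ℕ) (z : Fin N → Bool) :
    (D.outcomeLaw θ t).real {z}
      = ∏ i, Real.sigmoid ((if z i then 1 else -1) * D.score θ t i) := by
  rw [outcomeLaw, measureReal_def, Measure.pi_singleton, ENNReal.toReal_prod]
  refine Finset.prod_congr rfl fun i _ => ?_
  rw [← measureReal_def]
  cases h : z i
  · rw [ProbabilityTheory.bernoulliMeasure_real_apply_of_notMem_of_mem _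
      (MeasurableSet.singleton _) (by simp) (by simp)]
    simp only [Bool.false_eq_true, if_false, neg_mul, one_mul, Real.sigmoid_neg]
    rfl
  · rw [ProbabilityTheory.bernoulliMeasure_real_apply_of_mem_of_notMem _
      (MeasurableSet.singleton _) (by simp) (by simp)]
    simp only [if_true, one_mul]
    rfl

instance (θ : DRParam N m) (t : ℕ) : IsProbabilityMeasure (D.outcomeLaw θ t) := by
  unfold outcomeLaw
  infer_instance

theorem isProbabilityMeasure_historyLaw [IsProbabilityMeasure prior] (θ : DRParam N m) :
    ∀ t, (∀ s < t, Measurable (oracle s)) →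
      IsProbabilityMeasure (D.historyLaw prior oracle θ t)
  | 0, _ => by
    unfold historyLaw
    infer_instance
  | t + 1, hO => by
    have := isProbabilityMeasure_historyLaw θ t fun s hs => hO s (hs.trans t.lt_succ_self)
    unfold historyLaw
    refine isProbabilityMeasure_bind (measurable_of_countable _).aemeasurable
      (ae_of_all _ fun h => ?_)
    have := D.isProbabilityMeasure_selectionLaw prior oracle (hO t t.lt_succ_self) h
    exact Measure.isProbabilityMeasure_map (measurable_of_countable _).aemeasurable

theorem integral_historyLaw_succ [IsProbabilityMeasure prior] (θ : DRParam N m) {t : ℕ}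
    (hO : ∀ s < t + 1, Measurable (oracle s)) (g : DRHistory N (t + 1) → ℝ) :
    ∫ h, g h ∂D.historyLaw prior oracle θ (t + 1)
      = ∫ h, ∑ S, D.selProb prior oracle t h S *
          ∑ z, (∏ i, Real.sigmoid ((if z i then 1 else -1) * D.score θ t i)) *
            g (Fin.snoc h ((S, z) : DRRound N)) ∂D.historyLaw prior oracle θ t := by
  have := D.isProbabilityMeasure_historyLaw prior oracle θ (t + 1) hO
  -- Histories form a finite discrete space, so the transition is automatically a kernel, and the
  -- integral formula for compositions of kernels applies.
  have hb : D.historyLaw prior oracle θ (t + 1) = (D.historyLaw prior oracle θ t).bind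
      (ProbabilityTheory.Kernel.ofFunOfCountable fun h =>
        ((D.selectionLaw prior oracle t h).prod (D.outcomeLaw θ t)).map fun ρ =>
        (Fin.snoc h ρ : DRHistory N (t + 1))) := rfl
  have hg : Integrable g (D.historyLaw prior oracle θ (t + 1)) := .of_finite
  rw [hb] at hg ⊢
  refine (ProbabilityTheory.Kernel.integral_comp (a := ())
    (κ := ProbabilityTheory.Kernel.const Unit (D.historyLaw prior oracle θ t)) hg).trans ?_
  refine integral_congr_ae (ae_of_all _ fun h => ?_)
  have := D.isProbabilityMeasure_selectionLaw prior oracle (hO t t.lt_succ_self) h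
  change ∫ z, g z ∂(((D.selectionLaw prior oracle t h).prod (D.outcomeLaw θ t)).map fun ρ =>
        (Fin.snoc h ρ : DRHistory N (t + 1))) = _
  rw [integral_map (measurable_of_countable _).aemeasurable
    (measurable_of_countable _).aestronglyMeasurable, integral_fintype .of_finite,
    Fintype.sum_prod_type]
  refine Finset.sum_congr rfl fun S _ => ?_
  rw [Finset.mul_sum]
  refine Finset.sum_congr rfl fun z _ => ?_
  rw [← Set.singleton_prod_singleton, measureReal_prod_prod, outcomeLaw_real_singleton, selProb,
    smul_eq_mul, mul_assoc]

/-! ### Erasing unobserved outcomes, and the density of the observed history -/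

/-- The observed part of a round: the outcomes of customers that are not selected are erased. -/
def maskRound (ρ : DRRound N) : DRRound N :=
  (ρ.1, fun i => if i ∈ ρ.1 then ρ.2 i else false)

/-- The observed part of a history. -/
def maskHist {t : ℕ} (h : DRHistory N t) : DRHistory N t :=
  fun s => maskRound (h s)

theorem maskRound_maskRound (ρ : DRRound N) : maskRound (maskRound ρ) = maskRound ρ := by
  refine Prod.ext rfl (funext fun i => ?_)
  by_cases hi : i ∈ ρ.1 <;> simp [maskRound, hi]

theorem maskHist_maskHist {t : ℕ} (h : DRHistory N t) : maskHist (maskHist h) = maskHist h :=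
  funext fun s => maskRound_maskRound (h s)

theorem maskHist_snoc {t : ℕ} (h : DRHistory N t) (ρ : DRRound N) :
    maskHist (Fin.snoc h ρ : DRHistory N (t + 1))
      = (Fin.snoc (maskHist h) (maskRound ρ) : DRHistory N (t + 1)) :=
  Fin.comp_snoc maskRound h ρ

theorem likelihood_maskRound (t : ℕ) (ρ : DRRound N) :
    D.likelihood t (maskRound ρ) = D.likelihood t ρ := by
  funext θ
  refine Finset.prod_congr rfl fun i (hi : i ∈ ρ.1) => ?_
  simp [maskRound, hi]

theorem posterior_maskHist : ∀ (t : ℕ) (h : DRHistory N t),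
    D.posterior prior t (maskHist h) = D.posterior prior t h
  | 0, _ => rfl
  | t + 1, h => by
    have h1 : Fin.init (maskHist h) = maskHist (Fin.init h) := rfl
    have h2 : maskHist h (Fin.last t) = maskRound (h (Fin.last t)) := rfl
    simp only [posterior, bayesUpdate, h1, h2, likelihood_maskRound, posterior_maskHist t]

theorem selProb_maskHist (t : ℕ) (h : DRHistory N t) :
    D.selProb prior oracle t (maskHist h) = D.selProb prior oracle t h := by
  funext S
  simp only [selProb, selectionLaw, posterior_maskHist]

/-- The weight of a round with the fictitious outcomes of unselected customers made uniform. -/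
noncomputable def roundLaw (θ : DRParam N m) (t : ℕ) (S : Finset (Fin N)) (i : Fin N) (c : Bool) :
    ℝ :=
  if i ∈ S then Real.sigmoid ((if c then 1 else -1) * D.score θ t i) else 1 / 2

theorem sum_roundLaw (θ : DRParam N m) (t : ℕ) (S : Finset (Fin N)) (i : Fin N) :
    ∑ c, D.roundLaw θ t S i c = 1 := by
  by_cases hi : i ∈ S <;> simp [roundLaw, hi, Real.sigmoid_neg]

/-- The reason for the uniform weights: the factor in front of the likelihood is free of `θ`. -/
theorem prod_roundLaw (θ : DRParam N m) (t : ℕ) (S : Finset (Fin N)) (z : Fin N → Bool) :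
    ∏ i, D.roundLaw θ t S i (z i)
      = (1 / 2) ^ (N - S.card) * D.likelihood t ((S, z) : DRRound N) θ := by
  unfold roundLaw likelihood
  rw [Finset.prod_ite, mul_comm, Finset.prod_const]
  congr 2
  · rw [← Finset.compl_filter, Finset.card_compl]
    simp
  · simp

theorem sum_prod_roundLaw (θ : DRParam N m) (t : ℕ) (S : Finset (Fin N)) :
    ∑ z : Fin N → Bool, ∏ i, D.roundLaw θ t S i (z i) = 1 := by
  rw [← Fintype.prod_sum]
  exact Finset.prod_eq_one fun i _ => D.sum_roundLaw θ t S i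

theorem sum_prod_roundLaw_mul_indicator (θ : DRParam N m) (t : ℕ) {S : Finset (Fin N)} {i : Fin N}
    (hi : i ∈ S) :
    ∑ z : Fin N → Bool, (∏ j, D.roundLaw θ t S j (z j)) * (if z i then 1 else 0)
      = D.stayProb θ t i := by
  rw [sum_prod_mul_apply _ (D.sum_roundLaw θ t S) i fun c => if c then 1 else 0]
  simp [roundLaw, hi, stayProb]

/-- Masking sends both outcomes of an unselected customer to `false`, so the pushforward under
masking does not see which law such an outcome has. -/
theorem sum_outcome_eq_sum_roundLaw (θ : DRParam N m) (t : ℕ) (S : Finset (Fin N))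
    (G : DRRound N → ℝ) (hG : ∀ ρ, G (maskRound ρ) = G ρ) :
    ∑ z, (∏ i, Real.sigmoid ((if z i then 1 else -1) * D.score θ t i)) * G (S, z)
      = ∑ z, (∏ i, D.roundLaw θ t S i (z i)) * G (S, z) := by
  have := sum_prod_mul_comp_congr
    (fun i (c : Bool) => Real.sigmoid ((if c then 1 else -1) * D.score θ t i))
    (D.roundLaw θ t S) (fun i c => if i ∈ S then c else false) ?_ (fun w => G (S, w))
  · have e : ∀ z, G (S, fun j => if j ∈ S then z j else false) = G (S, z) := fun z => hG (S, z)
    simpa only [e] using this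
  · intro i w
    by_cases hi : i ∈ S
    · simp [hi, roundLaw]
    · cases w
      · simp [hi, roundLaw, Real.sigmoid_neg]
      · simp [hi]

/-- The weight of a history, apart from the likelihood. -/
noncomputable def histWeight : (t : ℕ) → DRHistory N t → ℝ
  | 0, _ => 1
  | t + 1, h => histWeight t (Fin.init h) *
      (D.selProb prior oracle t (Fin.init h) (h (Fin.last t)).1 *
        (1 / 2) ^ (N - (h (Fin.last t)).1.card))

theorem histWeight_nonneg : ∀ (t : ℕ) (h : DRHistory N t), 0 ≤ D.histWeight prior oracle t h
  | 0, _ => zero_le_one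
  | t + 1, h => mul_nonneg (histWeight_nonneg t _)
      (mul_nonneg (D.selProb_nonneg prior oracle t _ _) (by positivity))

theorem sum_history_succ {M : Type*} [AddCommMonoid M] {t : ℕ} (F : DRHistory N (t + 1) → M) :
    ∑ h, F h = ∑ h : DRHistory N t, ∑ S, ∑ z, F (Fin.snoc h ((S, z) : DRRound N)) := by
  rw [← (Fin.snocEquiv fun _ : Fin (t + 1) => DRRound N).sum_comp, Fintype.sum_prod_type,
    Finset.sum_comm]
  refine Finset.sum_congr rfl fun h _ => ?_
  rw [Fintype.sum_prod_type]
  rfl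

/-- The counterpart of `integral_historyLaw_succ` for the weighted sums, with `roundLaw` in place of
the true outcome law. -/
theorem sum_histWeight_succ {t : ℕ} (θ : DRParam N m) (F : DRHistory N (t + 1) → ℝ) :
    ∑ h, D.histWeight prior oracle (t + 1) h * D.histLik (t + 1) h θ * F h
      = ∑ h, D.histWeight prior oracle t h * D.histLik t h θ *
          ∑ S, D.selProb prior oracle t h S * ∑ z, (∏ i, D.roundLaw θ t S i (z i)) *
            F (Fin.snoc h ((S, z) : DRRound N)) := by
  rw [sum_history_succ]
  refine Finset.sum_congr rfl fun h _ => ?_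
  rw [Finset.mul_sum]
  refine Finset.sum_congr rfl fun S _ => ?_
  rw [Finset.mul_sum, Finset.mul_sum]
  refine Finset.sum_congr rfl fun z _ => ?_
  rw [prod_roundLaw, histLik_snoc, histWeight]
  simp only [Fin.init_snoc, Fin.snoc_last]
  ring

/-- The law of the observed history has density `histWeight * histLik`. -/
theorem integral_historyLaw [IsProbabilityMeasure prior] (θ : DRParam N m) :
    ∀ (t : ℕ) (_ : ∀ s < t, Measurable (oracle s)) (g : DRHistory N t → ℝ)
      (_ : ∀ h, g (maskHist h) = g h),
    ∫ h, g h ∂D.historyLaw prior oracle θ t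
      = ∑ h, D.histWeight prior oracle t h * D.histLik t h θ * g h
  | 0, _, g, _ => by
    have : ∀ h : DRHistory N 0, h = Fin.elim0 := fun h => Subsingleton.elim _ _
    simp [historyLaw, histWeight, histLik, this]
  | t + 1, hO, g, hg => by
    rw [integral_historyLaw_succ D prior oracle θ hO, sum_histWeight_succ]
    have e : ∀ (h : DRHistory N t) (S : Finset (Fin N)),
        ∑ z, (∏ i, Real.sigmoid ((if z i then 1 else -1) * D.score θ t i)) *
            g (Fin.snoc h ((S, z) : DRRound N))
        = ∑ z, (∏ i, D.roundLaw θ t S i (z i)) * g (Fin.snoc h ((S, z) : DRRound N)) := by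
      intro h S
      refine D.sum_outcome_eq_sum_roundLaw θ t S (fun ρ => g (Fin.snoc h ρ)) fun ρ => ?_
      rw [← hg, ← hg (Fin.snoc h ρ), maskHist_snoc, maskHist_snoc, maskRound_maskRound]
    simp_rw [e]
    refine integral_historyLaw θ t (fun s hs => hO s (hs.trans t.lt_succ_self)) _ fun h => ?_
    have e' : ∀ ρ : DRRound N, g (Fin.snoc (maskHist h) ρ) = g (Fin.snoc h ρ) := fun ρ => by
      rw [← hg, ← hg (Fin.snoc h ρ), maskHist_snoc, maskHist_snoc, maskHist_maskHist]
    simp only [selProb_maskHist, e']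

theorem sum_histWeight_mul_histLik [IsProbabilityMeasure prior] (θ : DRParam N m) (t : ℕ)
    (hO : ∀ s < t, Measurable (oracle s)) :
    ∑ h, D.histWeight prior oracle t h * D.histLik t h θ = 1 := by
  have := D.isProbabilityMeasure_historyLaw prior oracle θ t hO
  simpa using (D.integral_historyLaw prior oracle θ t hO (fun _ => 1) fun _ => rfl).symm

/-- The rounds after `t` integrate to one, and so do the outcomes of round `t`, which are drawn
independently of the selection. -/
theorem integral_selection_historyLaw [IsProbabilityMeasure prior] (θ : DRParam N m) (t : ℕ)
    (F : Finset (Fin N) → ℝ) (T : ℕ) (ht : t + 1 ≤ T) (hO : ∀ s < T, Measurable (oracle s)) :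
    ∫ h : DRHistory N T, F (h ⟨t, ht⟩).1 ∂D.historyLaw prior oracle θ T
      = ∑ h, D.histWeight prior oracle t h * D.histLik t h θ *
          ∑ S, D.selProb prior oracle t h S * F S := by
  have hout : ∀ t, ∑ z : Fin N → Bool,
      ∏ i, Real.sigmoid ((if z i then 1 else -1) * D.score θ t i) = 1 := by
    intro t
    rw [← Fintype.prod_sum fun i (c : Bool) =>
      Real.sigmoid ((if c then 1 else -1) * D.score θ t i)]
    simp [Real.sigmoid_neg]
  induction T, ht using Nat.le_induction with
  | base =>
    rw [integral_historyLaw_succ D prior oracle θ hO]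
    have e : ∀ (h : DRHistory N t) (S : Finset (Fin N)) (z : Fin N → Bool),
        ((Fin.snoc h ((S, z) : DRRound N) : DRHistory N (t + 1)) ⟨t, Nat.lt_succ_self t⟩).1 = S :=
      fun h S z => congrArg Prod.fst (Fin.snoc_last (α := fun _ => DRRound N) _ _)
    simp_rw [e, ← Finset.sum_mul, hout, one_mul]
    refine D.integral_historyLaw prior oracle θ t (fun s hs => hO s (hs.trans t.lt_succ_self)) _ ?_
    intro h
    rw [selProb_maskHist]
  | succ n hn ih =>
    rw [integral_historyLaw_succ D prior oracle θ hO,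
      ← ih fun s hs => hO s (hs.trans n.lt_succ_self)]
    have e : ∀ (h : DRHistory N n) (S : Finset (Fin N)) (z : Fin N → Bool),
        ((Fin.snoc h ((S, z) : DRRound N) : DRHistory N (n + 1)) ⟨t, Nat.lt_succ_of_lt hn⟩)
          = h ⟨t, hn⟩ :=
      fun h S z => Fin.snoc_castSucc (α := fun _ => DRRound N) _ _ ⟨t, hn⟩
    simp_rw [e, ← Finset.sum_mul, hout, one_mul]
    refine integral_congr_ae (ae_of_all _ fun h => ?_)
    simp only [D.sum_selProb prior oracle (hO n n.lt_succ_self), one_mul]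

/-! ### Regret of a single round -/

theorem integrable_stayProb (P : Measure (DRParam N m)) [IsFiniteMeasure P] (t : ℕ) (i : Fin N) :
    Integrable (fun θ => D.stayProb θ t i) P :=
  Integrable.of_bound (D.measurable_stayProb t i).aestronglyMeasurable 1 <| ae_of_all _ fun θ => by
    rw [Real.norm_of_nonneg (D.stayProb_mem_Icc θ t i).1]
    exact (D.stayProb_mem_Icc θ t i).2

/-- The posterior mean of the probability that a customer stays in. -/
noncomputable def meanProb (t : ℕ) (h : DRHistory N t) (i : Fin N) : ℝ :=
  ∫ θ, D.stayProb θ t i ∂D.posterior prior t h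

/-- The posterior variance of the probability that a customer stays in. -/
noncomputable def varProb (t : ℕ) (h : DRHistory N t) (i : Fin N) : ℝ :=
  ∫ θ, (D.stayProb θ t i - D.meanProb prior t h i) ^ 2 ∂D.posterior prior t h

/-- The probability that a customer is selected after a history. -/
noncomputable def inclProb (t : ℕ) (h : DRHistory N t) (i : Fin N) : ℝ :=
  ∑ S, D.selProb prior oracle t h S * if i ∈ S then 1 else 0

theorem meanProb_mem_Icc [IsProbabilityMeasure prior] (t : ℕ) (h : DRHistory N t) (i : Fin N) :
    D.meanProb prior t h i ∈ Set.Icc (0 : ℝ) 1 := by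
  refine ⟨integral_nonneg fun θ => (D.stayProb_mem_Icc θ t i).1, ?_⟩
  have h1 := integral_mono (D.integrable_stayProb (D.posterior prior t h) t i) (integrable_const 1)
    fun θ => (D.stayProb_mem_Icc θ t i).2
  rw [integral_const, probReal_univ, one_smul] at h1
  exact h1

theorem integrable_sq_stayProb_sub (P : Measure (DRParam N m)) [IsFiniteMeasure P]
    [IsProbabilityMeasure prior] (t : ℕ) (h : DRHistory N t) (i : Fin N) :
    Integrable (fun θ => (D.stayProb θ t i - D.meanProb prior t h i) ^ 2) P :=
  Integrable.of_bound
    (((D.measurable_stayProb t i).sub_const _).pow_const 2).aestronglyMeasurable 1 <|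
    ae_of_all _ fun θ => by
      have h1 := D.stayProb_mem_Icc θ t i
      have h2 := D.meanProb_mem_Icc prior t h i
      rw [Real.norm_of_nonneg (sq_nonneg _), sq_le_one_iff_abs_le_one, abs_le]
      constructor <;> linarith [h1.1, h1.2, h2.1, h2.2]

theorem inclProb_eq [IsProbabilityMeasure prior] {t : ℕ} (hO : Measurable (oracle t))
    (h : DRHistory N t) (i : Fin N) :
    D.inclProb prior oracle t h i
      = (D.posterior prior t h).real {θ | i ∈ oracle t (D.stayProb θ t)} := by
  have hA : MeasurableSet {θ | i ∈ oracle t (D.stayProb θ t)} :=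
    D.measurable_oracle_stayProb oracle hO (measurableSet_mem_finset i)
  rw [inclProb, D.sum_selProb_mul prior oracle hO h fun S => if i ∈ S then 1 else 0,
    ← integral_indicator_one hA]
  refine integral_congr_ae (ae_of_all _ fun θ => ?_)
  simp [Set.indicator]

theorem measurable_comp_oracle {t : ℕ} (hO : Measurable (oracle t))
    {F : DRParam N m → Finset (Fin N) → ℝ} (hF : ∀ S, Measurable fun θ => F θ S) :
    Measurable fun θ => F θ (oracle t (D.stayProb θ t)) :=
  (measurable_from_prod_countable_left (f := fun q : DRParam N m × Finset (Fin N) => F q.1 q.2)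
    hF).comp (measurable_id.prodMk (D.measurable_oracle_stayProb oracle hO))

theorem measurable_meanReward (t : ℕ) (S : Finset (Fin N)) :
    Measurable fun θ => D.meanReward t θ S := by
  unfold meanReward objective
  exact Finset.measurable_sum _ fun i _ => (D.measurable_stayProb t i).const_mul _

theorem abs_meanReward_le (t : ℕ) (θ : DRParam N m) (S : Finset (Fin N)) :
    |D.meanReward t θ S| ≤ ∑ i, |D.d t i| := by
  unfold meanReward objective
  refine (Finset.abs_sum_le_sum_abs _ _).trans ((Finset.sum_le_sum fun i _ => ?_).trans
    (Finset.sum_le_sum_of_subset_of_nonneg (Finset.subset_univ S) fun i _ _ => abs_nonneg _))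
  rw [abs_mul, abs_of_nonneg (D.stayProb_mem_Icc θ t i).1]
  exact mul_le_of_le_one_right (abs_nonneg _) (D.stayProb_mem_Icc θ t i).2

/-- The expected regret of the selection that is made after a history. -/
noncomputable def stepRegret (t : ℕ) (h : DRHistory N t) (θ : DRParam N m) : ℝ :=
  ∑ S, D.selProb prior oracle t h S *
    (D.meanReward t θ (oracle t (D.stayProb θ t)) - D.meanReward t θ S)

theorem measurable_stepRegret {t : ℕ} (hO : Measurable (oracle t)) (h : DRHistory N t) :
    Measurable (D.stepRegret prior oracle t h) := by
  unfold stepRegret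
  exact Finset.measurable_sum _ fun S _ => ((D.measurable_comp_oracle oracle hO
    (D.measurable_meanReward t)).sub (D.measurable_meanReward t S)).const_mul _

theorem abs_stepRegret_le [IsProbabilityMeasure prior] {t : ℕ} (hO : Measurable (oracle t))
    (h : DRHistory N t) (θ : DRParam N m) :
    |D.stepRegret prior oracle t h θ| ≤ 2 * ∑ i, |D.d t i| := by
  unfold stepRegret
  calc _ ≤ ∑ S, D.selProb prior oracle t h S * (2 * ∑ i, |D.d t i|) := by
        refine (Finset.abs_sum_le_sum_abs _ _).trans (Finset.sum_le_sum fun S _ => ?_)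
        rw [abs_mul, abs_of_nonneg (D.selProb_nonneg prior oracle t h S)]
        refine mul_le_mul_of_nonneg_left ?_ (D.selProb_nonneg prior oracle t h S)
        refine (abs_sub _ _).trans ?_
        linarith [D.abs_meanReward_le t θ (oracle t (D.stayProb θ t)), D.abs_meanReward_le t θ S]
    _ = _ := by rw [← Finset.sum_mul, D.sum_selProb prior oracle hO, one_mul]

/-- The regret of one step in terms of the selection probabilities and the posterior variances. -/
theorem integral_stepRegret_le [IsProbabilityMeasure prior] {t : ℕ} (hO : Measurable (oracle t))
    (h : DRHistory N t) {lam : ℝ} (hlam : 0 < lam) :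
    ∫ θ, D.stepRegret prior oracle t h θ ∂D.posterior prior t h
      ≤ ∑ i, (D.d t i ^ 2 / (4 * lam) +
          lam * (D.inclProb prior oracle t h i * D.varProb prior t h i)) := by
  set ν := D.posterior prior t h
  have hmean : ∀ S, ∫ θ, D.meanReward t θ S ∂ν = ∑ i ∈ S, D.d t i * D.meanProb prior t h i := by
    intro S
    unfold meanReward objective
    rw [integral_finsetSum _ fun i _ => (D.integrable_stayProb ν t i).const_mul _]
    simp_rw [integral_const_mul]
    rfl
  have hint : ∀ {F : DRParam N m → Finset (Fin N) → ℝ} (c : ℝ), (∀ S, Measurable fun θ => F θ S) →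
      (∀ θ S, |F θ S| ≤ c) → Integrable (fun θ => F θ (oracle t (D.stayProb θ t))) ν :=
    fun c hF hc => Integrable.of_bound
      (D.measurable_comp_oracle oracle hO hF).aestronglyMeasurable c
      (ae_of_all _ fun θ => hc θ _)
  have hV := hint _ (D.measurable_meanReward t) (D.abs_meanReward_le t)
  have hS : ∀ S, Integrable (fun θ => D.meanReward t θ S) ν := fun S =>
    Integrable.of_bound (D.measurable_meanReward t S).aestronglyMeasurable _
      (ae_of_all _ fun θ => D.abs_meanReward_le t θ S)
  have hM : Integrable (fun θ => ∑ i ∈ oracle t (D.stayProb θ t), D.d t i * D.meanProb prior t h i)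
      ν := by
    refine hint (F := fun _ S => ∑ i ∈ S, D.d t i * D.meanProb prior t h i)
      (∑ S : Finset (Fin N), |∑ i ∈ S, D.d t i * D.meanProb prior t h i|)
      (fun S => measurable_const) fun θ S => ?_
    exact Finset.single_le_sum (f := fun S : Finset (Fin N) =>
      |∑ i ∈ S, D.d t i * D.meanProb prior t h i|) (fun _ _ => abs_nonneg _) (Finset.mem_univ S)
  -- Probability matching. The selection is independent of `θ` given the history, so its reward
  -- depends only on the posterior means; and it has the law of the oracle's choice at a posterior
  -- sample, so this reward can be evaluated along that choice.
  have h1 : ∫ θ, D.stepRegret prior oracle t h θ ∂ν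
      = ∫ θ, (D.meanReward t θ (oracle t (D.stayProb θ t))
        - ∑ i ∈ oracle t (D.stayProb θ t), D.d t i * D.meanProb prior t h i) ∂ν := by
    rw [integral_sub hV hM,
      ← D.sum_selProb_mul prior oracle hO h fun S => ∑ i ∈ S, D.d t i * D.meanProb prior t h i]
    unfold stepRegret
    rw [integral_finsetSum _ fun S _ => Integrable.const_mul (f := fun θ =>
      D.meanReward t θ (oracle t (D.stayProb θ t)) - D.meanReward t θ S) (hV.sub (hS S)) _]
    simp_rw [integral_const_mul]
    have : ∀ S, ∫ θ, (D.meanReward t θ (oracle t (D.stayProb θ t)) - D.meanReward t θ S) ∂ν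
        = ∫ θ, D.meanReward t θ (oracle t (D.stayProb θ t)) ∂ν
          - ∑ i ∈ S, D.d t i * D.meanProb prior t h i := by
      intro S
      rw [integral_sub hV (hS S), hmean]
    simp_rw [this, mul_sub, Finset.sum_sub_distrib, ← Finset.sum_mul,
      D.sum_selProb prior oracle hO, one_mul]
  have hA : ∀ i, MeasurableSet {θ | i ∈ oracle t (D.stayProb θ t)} := fun i =>
    D.measurable_oracle_stayProb oracle hO (measurableSet_mem_finset i)
  have hsub : ∀ i, Integrable (fun θ => D.stayProb θ t i - D.meanProb prior t h i) ν := fun i =>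
    (D.integrable_stayProb ν t i).sub (integrable_const _)
  have h2 : ∀ θ, D.meanReward t θ (oracle t (D.stayProb θ t))
        - ∑ i ∈ oracle t (D.stayProb θ t), D.d t i * D.meanProb prior t h i
      = ∑ i, D.d t i * Set.indicator {θ | i ∈ oracle t (D.stayProb θ t)}
          (fun θ => D.stayProb θ t i - D.meanProb prior t h i) θ := by
    intro θ
    unfold meanReward objective
    rw [← Finset.sum_sub_distrib]
    simp only [Set.indicator, Set.mem_ofPred_eq, mul_ite, mul_zero, Finset.sum_ite_mem,
      Finset.univ_inter, mul_sub]
  rw [h1]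
  simp_rw [h2]
  rw [integral_finsetSum _ fun i _ => ((hsub i).indicator (hA i)).const_mul _]
  refine Finset.sum_le_sum fun i _ => ?_
  rw [integral_const_mul, integral_indicator (hA i), inclProb_eq D prior oracle hO]
  exact mul_setIntegral_le ν _ (hsub i) (D.integrable_sq_stayProb_sub prior ν t h i) _ hlam

/-! ### Total regret as a weighted sum over histories -/

/-- Two maximizers have equal value, so `Sstar`, which need not be measurable, can be replaced by
the measurable oracle at the true parameters. -/
theorem regret_eq [IsProbabilityMeasure prior] {T : ℕ} {Sstar : ℕ → DRParam N m → Finset (Fin N)}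
    (hO : ∀ t < T, Measurable (oracle t))
    (hopt : ∀ t < T, ∀ p : Fin N → ℝ, (∀ i, p i ∈ Set.Icc (0 : ℝ) 1) →
      D.IsOptimal t p (oracle t p))
    (hstar : ∀ t < T, ∀ θ, D.IsOptimal t (D.stayProb θ t) (Sstar t θ)) (θ : DRParam N m) :
    D.regret prior oracle Sstar T θ = ∑ t : Fin T, ∑ h : DRHistory N t,
      D.histWeight prior oracle t h * D.histLik t h θ * D.stepRegret prior oracle t h θ := by
  unfold regret
  refine Finset.sum_congr rfl fun t _ => ?_
  have hs := hstar t t.2 θ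
  have ho := hopt t t.2 (D.stayProb θ t) (D.stayProb_mem_Icc θ t)
  have : D.meanReward t θ (Sstar t θ) = D.meanReward t θ (oracle t (D.stayProb θ t)) :=
    le_antisymm (ho.2 _ hs.1) (hs.2 _ ho.1)
  rw [this]
  exact D.integral_selection_historyLaw prior oracle θ t
    (fun S => D.meanReward t θ (oracle t (D.stayProb θ t)) - D.meanReward t θ S) T t.2 hO

theorem integrable_histLik_mul_stepRegret [IsProbabilityMeasure prior] {t : ℕ}
    (hO : Measurable (oracle t)) (h : DRHistory N t) :
    Integrable (fun θ => D.histLik t h θ * D.stepRegret prior oracle t h θ) prior :=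
  Integrable.of_bound ((D.measurable_histLik t h).mul
    (D.measurable_stepRegret prior oracle hO h)).aestronglyMeasurable (2 * ∑ i, |D.d t i|) <|
    ae_of_all _ fun θ => by
      rw [norm_mul, Real.norm_of_nonneg (D.histLik_pos t h θ).le]
      exact (mul_le_of_le_one_left (norm_nonneg _) (D.histLik_le_one t h θ)).trans
        (D.abs_stepRegret_le prior oracle hO h θ)

theorem integrable_regret [IsProbabilityMeasure prior] {T : ℕ}
    {Sstar : ℕ → DRParam N m → Finset (Fin N)}
    (hO : ∀ t < T, Measurable (oracle t))
    (hopt : ∀ t < T, ∀ p : Fin N → ℝ, (∀ i, p i ∈ Set.Icc (0 : ℝ) 1) →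
      D.IsOptimal t p (oracle t p))
    (hstar : ∀ t < T, ∀ θ, D.IsOptimal t (D.stayProb θ t) (Sstar t θ)) :
    Integrable (D.regret prior oracle Sstar T) prior := by
  rw [funext (D.regret_eq prior oracle hO hopt hstar)]
  refine integrable_finsetSum _ fun t _ => integrable_finsetSum _ fun h _ => ?_
  simp_rw [mul_assoc]
  exact (D.integrable_histLik_mul_stepRegret prior oracle (hO t t.2) h).const_mul _

/-- These weights are the marginal law of the observed history when the parameters are drawn from
the prior. -/
theorem sum_histWeight_mul_evidence [IsProbabilityMeasure prior] (t : ℕ)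
    (hO : ∀ s < t, Measurable (oracle s)) :
    ∑ h, D.histWeight prior oracle t h * D.evidence prior t h = 1 := by
  unfold evidence
  simp_rw [← integral_const_mul]
  rw [← integral_finsetSum _ fun h _ => (D.integrable_histLik prior t h).const_mul _]
  simp_rw [D.sum_histWeight_mul_histLik prior oracle _ t hO]
  simp

/-- The one-round bound is averaged over the marginal law of the history. The same `lam` serves for
all rounds and histories, so it can be chosen once, at the end. -/
theorem bayesRegret_le [IsProbabilityMeasure prior] {T : ℕ}
    {Sstar : ℕ → DRParam N m → Finset (Fin N)}
    (hO : ∀ t < T, Measurable (oracle t))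
    (hopt : ∀ t < T, ∀ p : Fin N → ℝ, (∀ i, p i ∈ Set.Icc (0 : ℝ) 1) →
      D.IsOptimal t p (oracle t p))
    (hstar : ∀ t < T, ∀ θ, D.IsOptimal t (D.stayProb θ t) (Sstar t θ)) {lam : ℝ} (hlam : 0 < lam) :
    D.bayesRegret prior oracle Sstar T ≤ (∑ t : Fin T, ∑ i, D.d t i ^ 2) / (4 * lam) +
      lam * ∑ t : Fin T, ∑ h : DRHistory N t,
        D.histWeight prior oracle t h * D.evidence prior t h *
          ∑ i, D.inclProb prior oracle t h i * D.varProb prior t h i := by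
  unfold bayesRegret
  simp_rw [D.regret_eq prior oracle hO hopt hstar, mul_assoc]
  rw [integral_finsetSum _ fun (t : Fin T) _ => integrable_finsetSum _ fun h _ =>
      (D.integrable_histLik_mul_stepRegret prior oracle (hO t t.2) h).const_mul _,
    Finset.sum_div, Finset.mul_sum, ← Finset.sum_add_distrib]
  refine Finset.sum_le_sum fun t _ => ?_
  rw [integral_finsetSum _ fun h _ =>
    (D.integrable_histLik_mul_stepRegret prior oracle (hO t t.2) h).const_mul _]
  have hone := D.sum_histWeight_mul_evidence prior oracle t fun s hs => hO s (hs.trans t.2)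
  calc _ ≤ ∑ h : DRHistory N t, D.histWeight prior oracle t h * (D.evidence prior t h *
        ∑ i, (D.d t i ^ 2 / (4 * lam) +
          lam * (D.inclProb prior oracle t h i * D.varProb prior t h i))) := by
        refine Finset.sum_le_sum fun h _ => ?_
        rw [integral_const_mul, ← evidence_mul_integral_posterior]
        exact mul_le_mul_of_nonneg_left (mul_le_mul_of_nonneg_left
          (D.integral_stepRegret_le prior oracle (hO t t.2) h hlam)
          (D.evidence_pos prior t h).le) (D.histWeight_nonneg prior oracle t h)
    _ = _ := by
        simp_rw [Finset.sum_add_distrib, ← Finset.mul_sum, ← Finset.sum_div, mul_add,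
          Finset.sum_add_distrib, ← mul_assoc, ← Finset.sum_mul, hone, one_mul, Finset.mul_sum]
        congr 1
        refine Finset.sum_congr rfl fun h _ => Finset.sum_congr rfl fun i _ => ?_
        ring

/-! ### Information gained in a round, and its chain rule -/

theorem integrable_likelihood (P : Measure (DRParam N m)) [IsFiniteMeasure P] (t : ℕ)
    (ρ : DRRound N) : Integrable (D.likelihood t ρ) P :=
  Integrable.of_bound (D.measurable_likelihood t ρ).aestronglyMeasurable 1 <|
    ae_of_all _ fun θ => by
    rw [Real.norm_of_nonneg (D.likelihood_pos t ρ θ).le]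
    exact D.likelihood_le_one t ρ θ

/-- The predictive weights of the outcomes of a round after a history. -/
noncomputable def predictiveLaw (t : ℕ) (h : DRHistory N t) (S : Finset (Fin N))
    (z : Fin N → Bool) : ℝ :=
  ∫ θ, ∏ i, D.roundLaw θ t S i (z i) ∂D.posterior prior t h

theorem integrable_prod_roundLaw (P : Measure (DRParam N m)) [IsFiniteMeasure P] (t : ℕ)
    (S : Finset (Fin N)) (z : Fin N → Bool) :
    Integrable (fun θ => ∏ i, D.roundLaw θ t S i (z i)) P := by
  simp_rw [prod_roundLaw]
  exact (D.integrable_likelihood P t (S, z)).const_mul _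

theorem predictiveLaw_eq [IsProbabilityMeasure prior] (t : ℕ) (h : DRHistory N t)
    (S : Finset (Fin N)) (z : Fin N → Bool) :
    D.predictiveLaw prior t h S z = (1 / 2) ^ (N - S.card) *
      (D.evidence prior (t + 1) (Fin.snoc h ((S, z) : DRRound N) : DRHistory N (t + 1))
        / D.evidence prior t h) := by
  unfold predictiveLaw
  simp_rw [prod_roundLaw]
  rw [integral_const_mul, integral_posterior]
  unfold evidence
  simp_rw [histLik_snoc]
  rw [div_eq_inv_mul (∫ θ, D.histLik t h θ * _ ∂prior)]

theorem predictiveLaw_pos [IsProbabilityMeasure prior] (t : ℕ) (h : DRHistory N t)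
    (S : Finset (Fin N)) (z : Fin N → Bool) : 0 < D.predictiveLaw prior t h S z := by
  rw [predictiveLaw_eq]
  have h1 := D.evidence_pos prior t h
  have h2 := D.evidence_pos prior (t + 1) (Fin.snoc h ((S, z) : DRRound N))
  positivity

theorem sum_predictiveLaw [IsProbabilityMeasure prior] (t : ℕ) (h : DRHistory N t)
    (S : Finset (Fin N)) : ∑ z, D.predictiveLaw prior t h S z = 1 := by
  unfold predictiveLaw
  rw [← integral_finsetSum _ fun z _ => D.integrable_prod_roundLaw _ t S z]
  simp_rw [sum_prod_roundLaw]
  simp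

theorem sum_predictiveLaw_mul_indicator [IsProbabilityMeasure prior] (t : ℕ) (h : DRHistory N t)
    {S : Finset (Fin N)} {i : Fin N} (hi : i ∈ S) :
    ∑ z, D.predictiveLaw prior t h S z * (if z i then 1 else 0) = D.meanProb prior t h i := by
  unfold predictiveLaw
  simp_rw [← integral_mul_const]
  rw [← integral_finsetSum _ fun z _ => (D.integrable_prod_roundLaw _ t S z).mul_const _]
  simp_rw [D.sum_prod_roundLaw_mul_indicator _ t hi]
  rfl

theorem prod_roundLaw_pos (θ : DRParam N m) (t : ℕ) (S : Finset (Fin N)) (z : Fin N → Bool) :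
    0 < ∏ i, D.roundLaw θ t S i (z i) := by
  rw [prod_roundLaw]
  exact mul_pos (by positivity) (D.likelihood_pos t _ θ)

/-- The observation of a round is at least as informative as that of one selected customer. -/
theorem sum_sq_le_mul_relative_entropy [IsProbabilityMeasure prior] (t : ℕ) (h : DRHistory N t)
    (θ : DRParam N m) (S : Finset (Fin N)) :
    ∑ i ∈ S, (D.stayProb θ t i - D.meanProb prior t h i) ^ 2
      ≤ N * ∑ z, (∏ i, D.roundLaw θ t S i (z i)) *
        Real.log ((∏ i, D.roundLaw θ t S i (z i)) / D.predictiveLaw prior t h S z) := by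
  set kl := ∑ z, (∏ i, D.roundLaw θ t S i (z i)) *
        Real.log ((∏ i, D.roundLaw θ t S i (z i)) / D.predictiveLaw prior t h S z)
  have key : ∀ g : (Fin N → Bool) → ℝ, (∀ z, g z ∈ Set.Icc (0 : ℝ) 1) →
      (∑ z, (∏ i, D.roundLaw θ t S i (z i)) * g z
        - ∑ z, D.predictiveLaw prior t h S z * g z) ^ 2 ≤ kl :=
    fun g hg => sq_sum_sub_sum_le_sum_mul_log _ _ g (D.prod_roundLaw_pos θ t S)
      (D.predictiveLaw_pos prior t h S) (D.sum_prod_roundLaw θ t S)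
      (D.sum_predictiveLaw prior t h S) hg
  -- The zero test function shows that the relative entropy is nonnegative.
  have hkl : 0 ≤ kl := (sq_nonneg _).trans (key (fun _ => 0) fun _ => by simp)
  -- The outcome of each selected customer is a test function, bounded by the same relative entropy;
  -- there are at most `N` of them.
  calc _ ≤ ∑ _i ∈ S, kl := by
        refine Finset.sum_le_sum fun i hi => ?_
        have := key (fun z => if z i then 1 else 0) fun z => by cases z i <;> simp
        rwa [D.sum_prod_roundLaw_mul_indicator θ t hi,
          D.sum_predictiveLaw_mul_indicator prior t h hi] at this
    _ ≤ N * kl := by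
        rw [Finset.sum_const, nsmul_eq_mul]
        refine mul_le_mul_of_nonneg_right ?_ hkl
        exact_mod_cast (Finset.card_le_univ S).trans_eq (Fintype.card_fin N)

/-- Chain rule for fixed parameters: the log-ratio of the extended history is the old one plus that
of the new round, where the powers of `1 / 2` cancel. The mean of the new part dominates the squared
deviations of the selected customers, up to the factor `N`. -/
theorem sum_histWeight_mul_log_succ_ge [IsProbabilityMeasure prior] {t : ℕ}
    (hO : Measurable (oracle t)) (θ : DRParam N m) :
    (∑ h : DRHistory N t, D.histWeight prior oracle t h * D.histLik t h θ *
        ∑ i, D.inclProb prior oracle t h i * (D.stayProb θ t i - D.meanProb prior t h i) ^ 2) +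
      N * ∑ h : DRHistory N t, D.histWeight prior oracle t h * D.histLik t h θ *
        Real.log (D.histLik t h θ / D.evidence prior t h)
      ≤ N * ∑ h : DRHistory N (t + 1), D.histWeight prior oracle (t + 1) h *
        D.histLik (t + 1) h θ * Real.log (D.histLik (t + 1) h θ / D.evidence prior (t + 1) h) := by
  rw [sum_histWeight_succ, Finset.mul_sum, Finset.mul_sum, ← Finset.sum_add_distrib]
  refine Finset.sum_le_sum fun h _ => ?_
  have hZ := D.evidence_pos prior t h
  have hl := D.histLik_pos t h θ
  have hlog : ∀ S z, Real.log (D.histLik (t + 1) (Fin.snoc h ((S, z) : DRRound N)) θ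
        / D.evidence prior (t + 1) (Fin.snoc h ((S, z) : DRRound N)))
      = Real.log (D.histLik t h θ / D.evidence prior t h)
        + Real.log ((∏ i, D.roundLaw θ t S i (z i)) / D.predictiveLaw prior t h S z) := by
    intro S z
    have hZ' := D.evidence_pos prior (t + 1) (Fin.snoc h ((S, z) : DRRound N))
    have hk := D.likelihood_pos t (S, z) θ
    rw [← Real.log_mul (by positivity) (div_pos (D.prod_roundLaw_pos θ t S z)
      (D.predictiveLaw_pos prior t h S z)).ne', prod_roundLaw, predictiveLaw_eq, histLik_snoc]
    congr 1
    field_simp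
  have hsum : ∀ S, ∑ z, (∏ i, D.roundLaw θ t S i (z i)) *
      Real.log (D.histLik (t + 1) (Fin.snoc h ((S, z) : DRRound N)) θ
        / D.evidence prior (t + 1) (Fin.snoc h ((S, z) : DRRound N)))
      = Real.log (D.histLik t h θ / D.evidence prior t h) +
        ∑ z, (∏ i, D.roundLaw θ t S i (z i)) *
          Real.log ((∏ i, D.roundLaw θ t S i (z i)) / D.predictiveLaw prior t h S z) := by
    intro S
    simp_rw [hlog, mul_add]
    rw [Finset.sum_add_distrib, ← Finset.sum_mul, sum_prod_roundLaw, one_mul]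
  have hincl : ∑ i, D.inclProb prior oracle t h i *
        (D.stayProb θ t i - D.meanProb prior t h i) ^ 2
      = ∑ S, D.selProb prior oracle t h S *
        ∑ i ∈ S, (D.stayProb θ t i - D.meanProb prior t h i) ^ 2 := by
    simp_rw [inclProb, Finset.sum_mul]
    rw [Finset.sum_comm]
    refine Finset.sum_congr rfl fun S _ => ?_
    simp [Finset.mul_sum]
  simp_rw [hsum, mul_add]
  rw [Finset.sum_add_distrib, ← Finset.sum_mul, D.sum_selProb prior oracle hO, one_mul, hincl,
    mul_add, mul_add, add_comm]
  have hw := mul_nonneg (D.histWeight_nonneg prior oracle t h) hl.le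
  refine add_le_add le_rfl ?_
  rw [mul_left_comm (N : ℝ)]
  refine mul_le_mul_of_nonneg_left ?_ hw
  rw [Finset.mul_sum]
  refine Finset.sum_le_sum fun S _ => ?_
  rw [mul_left_comm]
  exact mul_le_mul_of_nonneg_left (D.sum_sq_le_mul_relative_entropy prior t h θ S)
    (D.selProb_nonneg prior oracle t h S)

theorem integrable_histLik_mul_log (P : Measure (DRParam N m)) [IsFiniteMeasure P]
    [IsProbabilityMeasure prior] (t : ℕ) (h : DRHistory N t) :
    Integrable (fun θ => D.histLik t h θ *
      Real.log (D.histLik t h θ / D.evidence prior t h)) P := by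
  have hZ := D.evidence_pos prior t h
  -- The likelihood lies in `(0, 1]`, where `u log u` is bounded although `log u` is not.
  have e : ∀ θ, D.histLik t h θ * Real.log (D.histLik t h θ / D.evidence prior t h)
      = Real.log (D.histLik t h θ) * D.histLik t h θ
        - D.histLik t h θ * Real.log (D.evidence prior t h) := by
    intro θ
    rw [Real.log_div (D.histLik_pos t h θ).ne' hZ.ne']
    ring
  simp_rw [e]
  refine Integrable.sub (Integrable.of_bound ((D.measurable_histLik t h).log.mul
    (D.measurable_histLik t h)).aestronglyMeasurable 1 (ae_of_all _ fun θ => ?_))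
    ((D.integrable_histLik P t h).mul_const _)
  exact (Real.abs_log_mul_self_lt _ (D.histLik_pos t h θ) (D.histLik_le_one t h θ)).le

/-- The mutual information of the parameters and the observed history. -/
noncomputable def information (t : ℕ) : ℝ :=
  ∑ h : DRHistory N t, D.histWeight prior oracle t h *
    ∫ θ, D.histLik t h θ * Real.log (D.histLik t h θ / D.evidence prior t h) ∂prior

theorem information_eq [IsProbabilityMeasure prior] (t : ℕ) :
    D.information prior oracle t = ∫ θ, ∑ h : DRHistory N t, D.histWeight prior oracle t h *
      D.histLik t h θ * Real.log (D.histLik t h θ / D.evidence prior t h) ∂prior := by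
  unfold information
  simp_rw [mul_assoc]
  rw [integral_finsetSum _ fun h _ => (D.integrable_histLik_mul_log prior prior t h).const_mul _]
  simp_rw [integral_const_mul]

/-- Integrating the pointwise inequality over the prior turns squared deviations, weighted by the
likelihood, into the evidence times the posterior variance. -/
theorem sum_gain_add_information_le [IsProbabilityMeasure prior] {t : ℕ}
    (hO : Measurable (oracle t)) :
    (∑ h : DRHistory N t, D.histWeight prior oracle t h * D.evidence prior t h *
        ∑ i, D.inclProb prior oracle t h i * D.varProb prior t h i) +
      N * D.information prior oracle t ≤ N * D.information prior oracle (t + 1) := by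
  have hint : ∀ t, Integrable (fun θ => ∑ h : DRHistory N t, D.histWeight prior oracle t h *
      D.histLik t h θ * Real.log (D.histLik t h θ / D.evidence prior t h)) prior := by
    intro t
    simp_rw [mul_assoc]
    exact integrable_finsetSum _ fun h _ =>
      (D.integrable_histLik_mul_log prior prior t h).const_mul _
  have hsq : ∀ (h : DRHistory N t) (i : Fin N), Integrable (fun θ => D.histLik t h θ *
      (D.stayProb θ t i - D.meanProb prior t h i) ^ 2) prior := fun h i =>
    (D.integrable_sq_stayProb_sub prior prior t h i).bdd_mul
      (D.measurable_histLik t h).aestronglyMeasurable (c := 1) (ae_of_all _ fun θ => by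
        rw [Real.norm_of_nonneg (D.histLik_pos t h θ).le]
        exact D.histLik_le_one t h θ)
  have hgain : ∀ h : DRHistory N t, ∀ θ, D.histWeight prior oracle t h * D.histLik t h θ *
        ∑ i, D.inclProb prior oracle t h i * (D.stayProb θ t i - D.meanProb prior t h i) ^ 2
      = ∑ i, D.histWeight prior oracle t h * D.inclProb prior oracle t h i * (D.histLik t h θ *
        (D.stayProb θ t i - D.meanProb prior t h i) ^ 2) := by
    intro h θ
    rw [Finset.mul_sum]
    exact Finset.sum_congr rfl fun i _ => by ring
  have hgi : ∀ h : DRHistory N t, Integrable (fun θ => D.histWeight prior oracle t h *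
      D.histLik t h θ * ∑ i, D.inclProb prior oracle t h i *
        (D.stayProb θ t i - D.meanProb prior t h i) ^ 2) prior := by
    intro h
    simp_rw [hgain]
    exact integrable_finsetSum _ fun i _ => (hsq h i).const_mul _
  have hmono := integral_mono ((integrable_finsetSum Finset.univ fun h _ => hgi h).add
    ((hint t).const_mul (N : ℝ))) ((hint (t + 1)).const_mul (N : ℝ))
    (D.sum_histWeight_mul_log_succ_ge prior oracle hO)
  rw [integral_add' (integrable_finsetSum _ fun h _ => hgi h) ((hint t).const_mul (N : ℝ)),
    integral_const_mul, integral_const_mul, ← information_eq, ← information_eq,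
    integral_finsetSum _ fun h _ => hgi h] at hmono
  refine le_trans (le_of_eq ?_) hmono
  congr 1
  refine Finset.sum_congr rfl fun h _ => ?_
  simp_rw [hgain]
  rw [integral_finsetSum _ fun i _ => (hsq h i).const_mul _, Finset.mul_sum]
  refine Finset.sum_congr rfl fun i _ => ?_
  rw [integral_const_mul, ← evidence_mul_integral_posterior]
  unfold varProb
  ring

theorem sum_gain_le_information [IsProbabilityMeasure prior] {T : ℕ}
    (hO : ∀ t < T, Measurable (oracle t)) :
    ∑ t : Fin T, ∑ h : DRHistory N t, D.histWeight prior oracle t h * D.evidence prior t h *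
        ∑ i, D.inclProb prior oracle t h i * D.varProb prior t h i
      ≤ N * D.information prior oracle T := by
  induction T with
  | zero => simp [information, evidence, histLik]
  | succ n ih =>
    rw [Fin.sum_univ_castSucc]
    have h1 := ih fun s hs => hO s (hs.trans n.lt_succ_self)
    have h2 := D.sum_gain_add_information_le prior oracle (hO n n.lt_succ_self)
    simp only [Fin.val_castSucc, Fin.val_last]
    linarith

/-! ### Covering bound for the mutual information -/

/-- The mutual information is at most one plus the log-cardinality of a finite set of parameters
that dominates the likelihood up to the factor `e`. -/
theorem information_le [IsProbabilityMeasure prior] {ι : Type*} [Fintype ι] [Nonempty ι]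
    (c : ι → DRParam N m) {t : ℕ} (hO : ∀ s < t, Measurable (oracle s))
    (hc : ∀ᵐ θ ∂prior, ∀ h : DRHistory N t,
      D.histLik t h θ ≤ Real.exp 1 * ∑ k, D.histLik t h (c k)) :
    D.information prior oracle t ≤ 1 + Real.log (Fintype.card ι) := by
  set K := (Fintype.card ι : ℝ)
  have hK : 0 < K := Nat.cast_pos.mpr Fintype.card_pos
  set M : DRHistory N t → ℝ := fun h => ∑ k, D.histLik t h (c k)
  have hM : ∀ h, 0 < M h := fun h =>
    Finset.sum_pos (fun k _ => D.histLik_pos t h _) Finset.univ_nonempty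
  have hh : ∀ h, ∫ θ, D.histLik t h θ * Real.log (D.histLik t h θ / D.evidence prior t h) ∂prior
      ≤ D.evidence prior t h * Real.log K + M h / K := by
    intro h
    have hZ := D.evidence_pos prior t h
    have h1 : ∫ θ, D.histLik t h θ * Real.log (D.histLik t h θ / D.evidence prior t h) ∂prior
        ≤ ∫ θ, D.histLik t h θ * Real.log (Real.exp 1 * M h / D.evidence prior t h) ∂prior := by
      refine integral_mono_ae (D.integrable_histLik_mul_log prior prior t h)
        ((D.integrable_histLik prior t h).mul_const _) ?_
      filter_upwards [hc] with θ hθ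
      have hl := D.histLik_pos t h θ
      exact mul_le_mul_of_nonneg_left (Real.log_le_log (by positivity)
        (div_le_div_of_nonneg_right (hθ h) hZ.le)) hl.le
    rw [integral_mul_const] at h1
    change _ ≤ D.evidence prior t h * _ at h1
    have hMh := hM h
    -- Comparison of the evidence with `M h / K`, the evidence of the uniform prior on the finite
    -- set. The `1` from `log e` cancels the `-1` in `log u ≤ u - 1`; the `1` in the conclusion is
    -- the total mass of the uniform mixture.
    have h2 : Real.exp 1 * M h / D.evidence prior t h
        = Real.exp 1 * K * (M h / (K * D.evidence prior t h)) := by field_simp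
    rw [h2, Real.log_mul (by positivity) (by positivity), Real.log_mul (by positivity) hK.ne',
      Real.log_exp] at h1
    have h3 : Real.log (M h / (K * D.evidence prior t h)) ≤ M h / (K * D.evidence prior t h) - 1 :=
      Real.log_le_sub_one_of_pos (by positivity)
    have h4 : D.evidence prior t h * (M h / (K * D.evidence prior t h)) = M h / K := by field_simp
    nlinarith [mul_le_mul_of_nonneg_left h3 hZ.le]
  calc _ ≤ ∑ h, D.histWeight prior oracle t h *
        (D.evidence prior t h * Real.log K + M h / K) :=
        Finset.sum_le_sum fun h _ =>
          mul_le_mul_of_nonneg_left (hh h) (D.histWeight_nonneg prior oracle t h)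
    _ = Real.log K + (∑ k, ∑ h, D.histWeight prior oracle t h * D.histLik t h (c k)) / K := by
        simp_rw [mul_add, Finset.sum_add_distrib, ← mul_assoc, ← Finset.sum_mul,
          D.sum_histWeight_mul_evidence prior oracle t hO, one_mul]
        rw [Finset.sum_comm, Finset.sum_div]
        simp_rw [M, ← Finset.mul_sum, mul_div_assoc]
    _ = _ := by
        simp_rw [D.sum_histWeight_mul_histLik prior oracle _ t hO]
        rw [Finset.sum_const, nsmul_one, Finset.card_univ]
        change Real.log K + K / K = _
        rw [div_self hK.ne', add_comm]

theorem abs_score_sub_le {t : ℕ} {i : Fin N} (hx : ‖D.context t i‖ ≤ 1) {θ θ' : DRParam N m}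
    {ε : ℝ} (hθ : ∀ i j, |θ i j - θ' i j| ≤ ε) :
    |D.score θ t i - D.score θ' t i| ≤ ((m : ℝ) + 1) * ε := by
  unfold score
  rw [← Finset.sum_sub_distrib]
  refine (Finset.abs_sum_le_sum_abs _ _).trans ?_
  have : ∀ j ∈ Finset.univ, |D.context t i j * θ i j - D.context t i j * θ' i j| ≤ ε := by
    intro j _
    rw [← mul_sub, abs_mul]
    exact (mul_le_of_le_one_left (abs_nonneg _) ((norm_le_pi_norm _ j).trans hx)).trans (hθ i j)
  refine (Finset.sum_le_card_nsmul _ _ _ this).trans_eq ?_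
  simp

theorem likelihood_le_exp_mul {t : ℕ} (hx : ∀ i, ‖D.context t i‖ ≤ 1) {θ θ' : DRParam N m}
    {ε : ℝ} (hε : 0 ≤ ε) (hθ : ∀ i j, |θ i j - θ' i j| ≤ ε) (ρ : DRRound N) :
    D.likelihood t ρ θ ≤ Real.exp (N * (((m : ℝ) + 1) * ε)) * D.likelihood t ρ θ' := by
  have h1 : D.likelihood t ρ θ
      ≤ ∏ i ∈ ρ.1, (Real.exp (((m : ℝ) + 1) * ε) *
          Real.sigmoid ((if ρ.2 i then 1 else -1) * D.score θ' t i)) := by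
    refine Finset.prod_le_prod (fun _ _ => Real.sigmoid_nonneg _) fun i _ => ?_
    refine (Real.sigmoid_le_exp_abs_sub_mul _ ((if ρ.2 i then 1 else -1) * D.score θ' t i)).trans ?_
    refine mul_le_mul_of_nonneg_right (Real.exp_le_exp.mpr ?_) (Real.sigmoid_nonneg _)
    rw [← mul_sub, abs_mul]
    refine le_trans (le_of_eq ?_) (D.abs_score_sub_le (hx i) hθ)
    cases ρ.2 i <;> simp
  refine h1.trans ?_
  rw [Finset.prod_mul_distrib, Finset.prod_const, ← Real.exp_nat_mul]
  refine mul_le_mul_of_nonneg_right (Real.exp_le_exp.mpr ?_) (D.likelihood_pos t ρ θ').le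
  refine mul_le_mul_of_nonneg_right ?_ (by positivity)
  exact_mod_cast (Finset.card_le_univ ρ.1).trans_eq (Fintype.card_fin N)

theorem histLik_le_exp_mul {θ θ' : DRParam N m} {ε : ℝ} (hε : 0 ≤ ε)
    (hθ : ∀ i j, |θ i j - θ' i j| ≤ ε) :
    ∀ (t : ℕ) (_ : ∀ s < t, ∀ i, ‖D.context s i‖ ≤ 1) (h : DRHistory N t),
      D.histLik t h θ ≤ Real.exp (t * (N * (((m : ℝ) + 1) * ε))) * D.histLik t h θ'
  | 0, _, _ => by simp [histLik]
  | t + 1, hx, h => by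
    have h1 := histLik_le_exp_mul hε hθ t (fun s hs => hx s (hs.trans t.lt_succ_self)) (Fin.init h)
    have h2 := D.likelihood_le_exp_mul (hx t t.lt_succ_self) hε hθ (h (Fin.last t))
    have h3 := mul_le_mul h1 h2 (D.likelihood_pos _ _ _).le
      (mul_nonneg (Real.exp_nonneg _) (D.histLik_pos _ _ _).le)
    refine h3.trans_eq ?_
    rw [mul_mul_mul_comm, ← Real.exp_add, histLik]
    congr 2
    push_cast
    ring

/-- Rounding each coordinate to a grid of mesh `2 L / k` changes the log-likelihood of `T` rounds by
at most `X / k ≤ 1`, which gives the factor `e` in `information_le`. -/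
theorem information_le_of_norm_le [IsProbabilityMeasure prior] {T : ℕ} {L : ℝ} (hL0 : 0 ≤ L)
    (hL : ∀ᵐ θ ∂prior, ‖θ‖ ≤ L) (hx : ∀ t < T, ∀ i, ‖D.context t i‖ ≤ 1)
    (hO : ∀ t < T, Measurable (oracle t)) :
    D.information prior oracle T
      ≤ 1 + N * ((m : ℝ) + 1) * Real.log (2 * (((m : ℝ) + 1) * L) * N * T + 3) := by
  set X : ℝ := 2 * (((m : ℝ) + 1) * L) * N * T with hX
  have hX0 : 0 ≤ X := by positivity
  -- The extra one keeps `k` positive when `X = 0`. An axis has `k + 1 ≤ X + 3` grid points.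
  set k := ⌈X⌉₊ + 1
  have hk : 0 < k := Nat.succ_pos _
  have hk' : (0 : ℝ) < k := by exact_mod_cast hk
  have hkX : X ≤ k := (Nat.le_ceil X).trans (by exact_mod_cast Nat.le_succ _)
  have hkX' : (k : ℝ) + 1 ≤ X + 3 := by
    have := (Nat.ceil_lt_add_one hX0).le
    simp only [k]
    push_cast
    linarith
  set c : (Fin N → Fin (m + 1) → Fin (k + 1)) → DRParam N m :=
    fun f i j => -L + 2 * L / k * (f i j : ℕ)
  have hc : ∀ᵐ θ ∂prior, ∀ h : DRHistory N T,
      D.histLik T h θ ≤ Real.exp 1 * ∑ f, D.histLik T h (c f) := by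
    filter_upwards [hL] with θ hθ h
    have hθ' : ∀ i j, |θ i j| ≤ L := fun i j =>
      ((norm_le_pi_norm (θ i) j).trans (norm_le_pi_norm θ i)).trans hθ
    choose f hf using fun i j => exists_grid_point_near hk (hθ' i j)
    have h1 := D.histLik_le_exp_mul (θ' := c f) (by positivity) hf T hx h
    refine h1.trans ?_
    have h2 : (T : ℝ) * (N * (((m : ℝ) + 1) * (2 * L / k))) ≤ 1 := by
      have : (T : ℝ) * (N * (((m : ℝ) + 1) * (2 * L / k))) = X / k := by
        rw [hX]
        ring
      rw [this]
      exact div_le_one_of_le₀ hkX hk'.le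
    refine mul_le_mul (Real.exp_le_exp.mpr h2) ?_ (D.histLik_pos _ _ _).le (Real.exp_nonneg _)
    exact Finset.single_le_sum (f := fun f => D.histLik T h (c f))
      (fun f _ => (D.histLik_pos T h (c f)).le) (Finset.mem_univ f)
  refine (D.information_le prior oracle c hO hc).trans ?_
  have hcard : Real.log (Fintype.card (Fin N → Fin (m + 1) → Fin (k + 1)))
      = N * ((m : ℝ) + 1) * Real.log ((k : ℝ) + 1) := by
    simp only [Fintype.card_pi, Fintype.card_fin, Finset.prod_const, Finset.card_univ,
      Nat.cast_pow, Real.log_pow]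
    push_cast
    ring
  rw [hcard]
  have := Real.log_le_log (by positivity) hkX'
  gcongr

theorem dInf_le {T t : ℕ} (ht : t < T) (i : Fin N) : D.dInf T ≤ D.d t i :=
  ciInf_le (Set.finite_range fun q : Fin T × Fin N => D.d q.1 q.2).bddBelow (⟨t, ht⟩, i)

theorem le_dSup {T t : ℕ} (ht : t < T) (i : Fin N) : D.d t i ≤ D.dSup T :=
  le_ciSup (Set.finite_range fun q : Fin T × Fin N => D.d q.1 q.2).bddAbove (⟨t, ht⟩, i)

theorem sum_le_totalSup {T t : ℕ} (ht : t < T) : ∑ i, D.d t i ≤ D.totalSup T :=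
  le_ciSup (Set.finite_range fun t : Fin T => ∑ i, D.d t i).bddAbove ⟨t, ht⟩

end DRInstance

/-! ### Final estimates and choice of the parameter -/

/-- The logarithm grows at most linearly in `a` and `N`, plus `log T`; then `1 + a ≤ e^a` and `log T
≥ log 2 ≥ 1 / 2` absorb every term. The square leaves much slack, and `14` is `7` divided by the
lower bound `1 / 2` for `M e^a log T`. -/
theorem log_information_bound {N T M a : ℝ} (hN : 1 ≤ N) (hT : 2 ≤ T) (hM : 1 ≤ M) (ha : 0 ≤ a) :
    1 + N * M * Real.log (2 * a * N * T + 3)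
      ≤ 14 * (M * N * Real.exp a * Real.log T) ^ 2 := by
  have hlT : 1 / 2 ≤ Real.log T := by
    have := Real.log_two_gt_d9
    have := Real.log_le_log two_pos hT
    linarith
  have hea : 1 + a ≤ Real.exp a := by linarith [Real.add_one_le_exp a]
  have hNT : 1 ≤ N * T := by nlinarith
  have h1 : Real.log (2 * a * N * T + 3) ≤ 2 * a + 2 + (N - 1) + Real.log T := by
    have e : 2 * a * N * T + 3 ≤ (2 * a + 3) * (N * T) := by nlinarith
    refine (Real.log_le_log (by positivity) e).trans ?_
    rw [Real.log_mul (by positivity) (by positivity), Real.log_mul (by positivity) (by positivity)]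
    have e1 := Real.log_le_sub_one_of_pos (show 0 < 2 * a + 3 by positivity)
    have e2 := Real.log_le_sub_one_of_pos (show 0 < N by positivity)
    linarith
  set E := Real.exp a
  set l := Real.log T
  have hE1 : 1 ≤ E := by linarith
  have hNM : 1 ≤ N * M := by nlinarith
  have hEl : 1 / 2 ≤ E * l := by nlinarith
  have hNEl : 1 / 2 ≤ N * (E * l) := by nlinarith
  have h2 : 2 + 2 * a + N + l ≤ 7 * (N * (E * l)) := by
    have e0 := mul_nonneg (sub_nonneg.mpr hN) (by linarith : (0 : ℝ) ≤ E * l)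
    have e1 : E ≤ 2 * (N * (E * l)) := by nlinarith
    have e2 : N ≤ 2 * (N * (E * l)) := by nlinarith
    have e3 : l ≤ N * (E * l) := by nlinarith
    nlinarith
  have h3 : 1 + N * M * Real.log (2 * a * N * T + 3) ≤ N * M * (7 * (N * (E * l))) := by
    have : N * M * Real.log (2 * a * N * T + 3) ≤ N * M * (1 + 2 * a + N + l) :=
      mul_le_mul_of_nonneg_left (by linarith) (by linarith)
    have := mul_le_mul_of_nonneg_left h2 (by linarith : (0 : ℝ) ≤ N * M)
    nlinarith
  refine h3.trans ?_
  have h4 : 1 / 2 ≤ M * (E * l) := by nlinarith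
  have h5 : (M * N * E * l) ^ 2 = N * M * (N * (E * l)) * (M * (E * l)) := by ring
  have h6 : 0 ≤ N * M * (N * (E * l)) := mul_nonneg (by linarith) (by linarith)
  rw [h5]
  nlinarith [mul_le_mul_of_nonneg_left h4 h6]

theorem theorem1 :
    ∃ C : ℝ, 0 < C ∧
      ∀ (N m T : ℕ) (L : ℝ) (D : DRInstance N m) (prior : Measure (DRParam N m))
        (oracle : ℕ → (Fin N → ℝ) → Finset (Fin N))
        (Sstar : ℕ → DRParam N m → Finset (Fin N)),
        2 ≤ T →
        IsProbabilityMeasure prior →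
        (∀ᵐ θ ∂prior, ‖θ‖ ≤ L) →
        (∀ t < T, ∀ i, ‖D.context t i‖ ≤ 1) →
        0 < D.dInf T →
        (∀ t < T, Measurable (oracle t)) →
        (∀ t < T, ∀ p : Fin N → ℝ, (∀ i, p i ∈ Set.Icc (0 : ℝ) 1) →
          D.IsOptimal t p (oracle t p)) →
        (∀ t < T, ∀ θ, D.IsOptimal t (D.stayProb θ t) (Sstar t θ)) →
        Integrable (D.regret prior oracle Sstar T) prior ∧
        D.bayesRegret prior oracle Sstar T ≤
          C * (D.totalSup T * ((m : ℝ) + 1) * (N : ℝ) ^ (3 / 2 : ℝ) *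
            Real.exp (((m : ℝ) + 1) * L) * (D.dSup T / D.dInf T) *
            (Real.sqrt T * Real.log T)) := by
  refine ⟨15, by norm_num, ?_⟩
  intro N m T L D prior oracle Sstar hT hprior hL hx hd hO hopt hstar
  refine ⟨D.integrable_regret prior oracle hO hopt hstar, ?_⟩
  have hT0 : 0 < T := by omega
  have hN : 0 < N := by
    -- Without customers, `dInf` is an infimum over an empty family, which is zero by convention, so
    -- its positivity excludes this case.
    rcases Nat.eq_zero_or_pos N with rfl | h
    · simp [DRInstance.dInf] at hd
    · exact h
  obtain ⟨θ₀, hθ₀⟩ := hL.exists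
  have hL0 : 0 ≤ L := (norm_nonneg θ₀).trans hθ₀
  have hdpos : ∀ t < T, ∀ i, 0 < D.d t i := fun t ht i => hd.trans_le (D.dInf_le ht i)
  have : Nonempty (Fin N) := ⟨⟨0, hN⟩⟩
  have hDpos : 0 < D.totalSup T :=
    (Finset.sum_pos (fun i _ => hdpos 0 hT0 i) Finset.univ_nonempty).trans_le
      (D.sum_le_totalSup hT0)
  have hratio : 1 ≤ D.dSup T / D.dInf T :=
    (one_le_div hd).mpr ((D.dInf_le hT0 ⟨0, hN⟩).trans (D.le_dSup hT0 ⟨0, hN⟩))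
  have hN' : (1 : ℝ) ≤ N := by exact_mod_cast hN
  have hT' : (2 : ℝ) ≤ T := by exact_mod_cast hT
  have hlT : 0 < Real.log T := Real.log_pos (by linarith)
  have hsT : 0 < √(T : ℝ) := Real.sqrt_pos.mpr (by linarith)
  set a := ((m : ℝ) + 1) * L with ha
  set B := ((m : ℝ) + 1) * (N : ℝ) ^ (3 / 2 : ℝ) * Real.exp a * Real.log T with hB
  have hBpos : 0 < B := by positivity
  have hNpow : ((N : ℝ) ^ (3 / 2 : ℝ)) ^ 2 = (N : ℝ) * N ^ 2 := by
    rw [← Real.rpow_natCast, ← Real.rpow_mul (by linarith)]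
    norm_num
    ring
  have hinfo : N * D.information prior oracle T ≤ 14 * B ^ 2 := by
    have h1 := D.information_le_of_norm_le prior oracle hL0 hL hx hO
    have h2 := log_information_bound hN' hT' (show (1 : ℝ) ≤ (m : ℝ) + 1 by simp)
      (show 0 ≤ a by positivity)
    have h3 : 14 * B ^ 2 = N * (14 * (((m : ℝ) + 1) * N * Real.exp a * Real.log T) ^ 2) := by
      rw [hB, mul_pow, mul_pow, mul_pow, hNpow]
      ring
    rw [h3]
    exact mul_le_mul_of_nonneg_left (h1.trans h2) (by linarith)
  -- The loads are positive, so the sum of their squares is at most the square of their sum; this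
  -- avoids a further factor from the number of customers.
  have hsq : ∑ t : Fin T, ∑ i, D.d t i ^ 2 ≤ T * D.totalSup T ^ 2 := by
    have : ∀ t ∈ (Finset.univ : Finset (Fin T)), ∑ i, D.d t i ^ 2 ≤ D.totalSup T ^ 2 := by
      intro t _
      exact (Finset.sum_sq_le_sq_sum_of_nonneg fun i _ => (hdpos t t.2 i).le).trans
        (pow_le_pow_left₀ (Finset.sum_nonneg fun i _ => (hdpos t t.2 i).le)
          (D.sum_le_totalSup t.2) 2)
    simpa using Finset.sum_le_card_nsmul _ _ _ this
  -- This choice makes both terms multiples of `D̄ √T B`, with coefficients `1 / 4` and `14`.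
  set lam := D.totalSup T * √T / B with hlam
  have hlampos : 0 < lam := by positivity
  have hmain := D.bayesRegret_le prior oracle hO hopt hstar hlampos
  have hgain := (D.sum_gain_le_information prior oracle hO).trans hinfo
  calc D.bayesRegret prior oracle Sstar T
      ≤ T * D.totalSup T ^ 2 / (4 * lam) + lam * (14 * B ^ 2) :=
        hmain.trans (add_le_add (div_le_div_of_nonneg_right hsq (by positivity))
          (mul_le_mul_of_nonneg_left hgain hlampos.le))
    _ = (57 / 4) * (D.totalSup T * √T * B) := by
        have hTT : (T : ℝ) = √T * √T := (Real.mul_self_sqrt (by linarith)).symm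
        rw [hlam]
        nth_rewrite 1 [hTT]
        field_simp
        ring
    _ ≤ 15 * (D.totalSup T * √T * B) := by
        have : 0 ≤ D.totalSup T * √T * B := by positivity
        linarith
    -- The ratio of the loads is at least one and enters only as slack.
    _ ≤ 15 * (D.totalSup T * √T * B * (D.dSup T / D.dInf T)) := by
        have : 0 ≤ D.totalSup T * √T * B := by positivity
        exact mul_le_mul_of_nonneg_left (le_mul_of_one_le_right this hratio) (by norm_num)
    _ = _ := by
        rw [hB]
        ring
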